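/- For an integer $m\ge 0$ let $B(m)$ be the number of triples $(\pi_1,\pi_2,\pi_3)$ of (possibly empty) partitions whose parts sum to $m$ in total, such that $\pi_1$ and $\pi_2$ each consist of distinct odd parts and every part of $\pi_3$ is divisible by $4$; put $B(m)=0$ for $m<0$. Then for every integer $n\ge 0$ the sum $$\sum_{k=-\infty}^{\infty}(-1)^k(3k+1)\,B\bigl(81n+70-54k(3k+2)\bigr)$$ has only finitely many nonzero terms, and $$\sum_{k=-\infty}^{\infty}(-1)^k(3k+1)\,B\bigl(81n+70-54k(3k+2)\bigr)\equiv 0\pmod 9 .$$ -/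

import Mathlib

/-- The finite set of all partition triples `(π₁, π₂, π₃)` of `n`, i.e. triples of partitions of
`m 0`, `m 1`, `m 2` with `m 0 + m 1 + m 2 = n`, such that `π₁` and `π₂` consist of distinct odd
parts and every part of `π₃` is divisible by `4`. Empty partitions are allowed. -/
def linTriples (n : ℕ) :
    Finset (Σ m : Fin 3 → ℕ, (m 0).Partition × (m 1).Partition × (m 2).Partition) :=
  (Finset.Nat.antidiagonalTuple 3 n).sigma fun m =>
    Nat.Partition.oddDistincts (m 0) ×ˢ Nat.Partition.oddDistincts (m 1) ×ˢ
      Nat.Partition.restricted (m 2) (fun i => 4 ∣ i)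

/-- `linB n` is the number of partition triples `(π₁, π₂, π₃)` of `n` such that `π₁` and `π₂`
consist of distinct odd parts and `π₃` consists of parts divisible by `4`. -/
def linB (n : ℕ) : ℕ := (linTriples n).card

/-- The function `linB` extended to all integers by `0` at negative arguments. -/
def linBInt (m : ℤ) : ℤ := if 0 ≤ m then (linB m.toNat : ℤ) else 0

/-! Write f_k for the Euler product `ef k`, with inverse `eg k`. Replacing q by -q in the generating
function of B gives G = f₁²/(f₂² f₄) (`coeff_generating`). Since 81n+70 = 27(3n+2)+16 and 27j+16 =
3(3(3j+1)+2)+1, the sum is, up to the sign (-1)^n, a coefficient obtained as follows: extract from G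
the residue classes 1, 2, 1 modulo 3 in succession (`sect`), multiply by the theta series ∑ (-1)^k
(3k+1) q^{2k(3k+2)}, and extract the class 2.

The exact input is that φ(-q) = f₁²/f₂ and ψ(q) = f₂²/f₁ are, up to factors in q³, equal to T - 2q
and T + q with the same T = t(q³), t = f₂f₃³/(f₁f₆³) (`phi_factor`, `psi_factor`). Taking the norm
of the second over the cube roots of unity shows that t³ + q is an eta quotient (`tq_cube_add_X`).
Now G = φ(-q)/(φ(-q²)ψ(q²)). Rationalising with s = t(q²) produces the denominators s³ - 8q² and s³
+ q², which agree modulo 9, so the first section is a short sum of eta quotients modulo 9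
(`sect_one_generating`). The next two sections use the dissections of f₁³ and of the cubic theta
function a(q) (`ef_one_cube_dissection`, `aq_dissection`) and end in 6 · `rest` modulo 9
(`sect_three_generating`).

Terms carrying a factor 3 matter only modulo 3, where f_{3k} = f_k³ makes sections of eta quotients
explicit and f₁⁸ = f₂⁴ + q f₄⁸ (`uf_fourth_power_relation`) simplifies them. Finally 3k+1 ≡ 1 modulo
3, so the theta series reduces to f₂f₁₂²/(f₄f₆); the class 2 of its product with `rest` vanishes
modulo 3 (`three_dvd_sect_two_mul_rest`), which together with the factor 6 gives divisibility by 9.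
-/

namespace ThetaDissection

open PowerSeries Finset Filter Topology
open scoped PowerSeries.WithPiTopology

/-! ### Gaussian binomials and the finite triple product -/

section FiniteTripleProduct
variable {R : Type*} [CommRing R]

/-- The finite `q`-Pochhammer product `(p; p)_m`. -/
def qPoch (p : R) (m : ℕ) : R := ∏ i ∈ range m, (1 - p ^ (i + 1))

/-- The Gaussian binomial coefficient, written with a given family `I` of inverses of the
`q`-Pochhammer products. -/
def gauss (p : R) (I : ℕ → R) (N j : ℕ) : R :=
  if j ≤ N then qPoch p N * I j * I (N - j) else 0

lemma qPoch_succ (p : R) (m : ℕ) : qPoch p (m + 1) = qPoch p m * (1 - p ^ (m + 1)) :=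
  prod_range_succ _ _

lemma inv_qPoch_pred {p : R} {I : ℕ → R} (hI : ∀ m, I m * qPoch p m = 1) (m : ℕ) :
    I m = (1 - p ^ (m + 1)) * I (m + 1) := by
  have h1 := hI m
  have h2 := hI (m + 1)
  rw [qPoch_succ] at h2
  linear_combination (-I m) * h2 + (I (m + 1) * (1 - p ^ (m + 1))) * h1

lemma gauss_zero_right {p : R} {I : ℕ → R} (hI : ∀ m, I m * qPoch p m = 1) (N : ℕ) :
    gauss p I N 0 = 1 := by
  have h0 := hI 0
  have h1 := hI N
  simp only [qPoch, range_zero, prod_empty, mul_one] at h0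
  simp only [gauss, Nat.zero_le, if_true, Nat.sub_zero, h0]
  linear_combination h1

lemma gauss_self {p : R} {I : ℕ → R} (hI : ∀ m, I m * qPoch p m = 1) (N : ℕ) :
    gauss p I N N = 1 := by
  have h0 := hI 0
  have h1 := hI N
  simp only [qPoch, range_zero, prod_empty, mul_one] at h0
  simp only [gauss, le_refl, if_true, Nat.sub_self, h0]
  linear_combination h1

lemma gauss_of_lt (p : R) (I : ℕ → R) {N j : ℕ} (h : N < j) : gauss p I N j = 0 :=
  if_neg (by omega)

/-- One of the two q-Pascal rules. It serves to adjoin a factor in `a` to the finite triple product;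
`gauss_succ'` serves for a factor in `b`. -/
lemma gauss_succ {p : R} {I : ℕ → R} (hI : ∀ m, I m * qPoch p m = 1) {N j : ℕ} (hj : j ≤ N) :
    gauss p I (N + 1) (j + 1) = gauss p I N (j + 1) + p ^ (N - j) * gauss p I N j := by
  obtain ⟨d, rfl⟩ := Nat.exists_eq_add_of_le hj
  rcases d with _ | d
  · rw [add_zero, gauss_self hI, gauss_self hI, gauss_of_lt _ _ (Nat.lt_succ_self _)]
    simp
  · have e1 := inv_qPoch_pred hI j
    have e2 := inv_qPoch_pred hI d
    simp only [gauss, show j + 1 ≤ j + (d + 1) + 1 by omega, show j + 1 ≤ j + (d + 1) by omega,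
      show j ≤ j + (d + 1) by omega, if_true, show j + (d + 1) + 1 - (j + 1) = d + 1 by omega,
      show j + (d + 1) - (j + 1) = d by omega, show j + (d + 1) - j = d + 1 by omega,
      qPoch_succ p (j + (d + 1))]
    rw [e1, e2]
    ring

lemma gauss_succ' {p : R} {I : ℕ → R} (hI : ∀ m, I m * qPoch p m = 1) {N j : ℕ} (hj : j ≤ N) :
    gauss p I (N + 1) (j + 1) = gauss p I N j + p ^ (j + 1) * gauss p I N (j + 1) := by
  obtain ⟨d, rfl⟩ := Nat.exists_eq_add_of_le hj
  rcases d with _ | d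
  · rw [add_zero, gauss_self hI, gauss_self hI, gauss_of_lt _ _ (Nat.lt_succ_self _)]
    simp
  · have e1 := inv_qPoch_pred hI j
    have e2 := inv_qPoch_pred hI d
    simp only [gauss, show j + 1 ≤ j + (d + 1) + 1 by omega, show j + 1 ≤ j + (d + 1) by omega,
      show j ≤ j + (d + 1) by omega, if_true, show j + (d + 1) + 1 - (j + 1) = d + 1 by omega,
      show j + (d + 1) - (j + 1) = d by omega, show j + (d + 1) - j = d + 1 by omega,
      qPoch_succ p (j + (d + 1))]
    rw [e1, e2]
    ring

/-- The triangular number `k (k + 1) / 2` of an integer. -/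
def tri (k : ℤ) : ℕ := (k * (k + 1) / 2).toNat

lemma two_mul_tri (k : ℤ) : 2 * (tri k : ℤ) = k * (k + 1) := by
  have h0 : 0 ≤ k * (k + 1) := by
    rcases le_or_gt 0 k with h | h
    · positivity
    · nlinarith
  have h2 : 2 ∣ k * (k + 1) := (Int.even_mul_succ_self k).two_dvd
  rw [tri, Int.toNat_of_nonneg (by omega)]
  omega

/-- The general term `a ^ (k (k + 1) / 2) * b ^ (k (k - 1) / 2)` of Ramanujan's theta function. -/
def thetaTerm (a b : R) (k : ℤ) : R := a ^ tri k * b ^ tri (-k)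

/-- The ratio of neighbouring terms is `a * (a * b) ^ k`. For negative `k` this is not available in
a ring, so powers `m` and `l` with `l = m - k` are put on the two sides. -/
lemma thetaTerm_add_one (a b : R) (k : ℤ) {m l : ℕ} (h : (l : ℤ) = m - k) :
    a * (a * b) ^ m * thetaTerm a b k = (a * b) ^ l * thetaTerm a b (k + 1) := by
  have e1 : 1 + m + tri k = l + tri (k + 1) := by
    have := two_mul_tri k
    have := two_mul_tri (k + 1)
    zify; linarith
  have e2 : m + tri (-k) = l + tri (-(k + 1)) := by
    have := two_mul_tri (-k)
    have := two_mul_tri (-(k + 1))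
    zify; linarith
  calc a * (a * b) ^ m * thetaTerm a b k = a ^ (1 + m + tri k) * b ^ (m + tri (-k)) := by
        rw [thetaTerm]; ring
    _ = _ := by rw [e1, e2, thetaTerm]; ring

lemma thetaTerm_sub_one (a b : R) (k : ℤ) {m l : ℕ} (h : (l : ℤ) = m + k) :
    b * (a * b) ^ m * thetaTerm a b k = (a * b) ^ l * thetaTerm a b (k - 1) := by
  have e1 : m + tri k = l + tri (k - 1) := by
    have := two_mul_tri k
    have := two_mul_tri (k - 1)
    zify; linarith
  have e2 : 1 + m + tri (-k) = l + tri (-(k - 1)) := by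
    have := two_mul_tri (-k)
    have := two_mul_tri (-(k - 1))
    zify; linarith
  calc b * (a * b) ^ m * thetaTerm a b k = a ^ (m + tri k) * b ^ (1 + m + tri (-k)) := by
        rw [thetaTerm]; ring
    _ = _ := by rw [e1, e2, thetaTerm]; ring

/-- The finite form of the Jacobi triple product identity. -/
theorem finite_triple_product {a b : R} {I : ℕ → R} (hI : ∀ m, I m * qPoch (a * b) m = 1)
    (m n : ℕ) :
    (∏ i ∈ range m, (1 + a * (a * b) ^ i)) * ∏ i ∈ range n, (1 + b * (a * b) ^ i) =
      ∑ j ∈ range (m + n + 1), gauss (a * b) I (m + n) j * thetaTerm a b (j - n) := by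
  induction n with
  | zero =>
    induction m with
    | zero =>
      simp [gauss_self hI, thetaTerm, tri]
    | succ m ih =>
      simp only [range_zero, prod_empty, mul_one, add_zero, Nat.cast_zero, sub_zero] at ih ⊢
      rw [prod_range_succ, ih, mul_add, mul_one, sum_range_succ' _ (m + 1)]
      rw [sum_range_succ' (n := m)]
      have key : ∀ j ∈ range (m + 1), gauss (a * b) I (m + 1) (j + 1) *
          thetaTerm a b ((j + 1 : ℕ) : ℤ)
          = gauss (a * b) I m (j + 1) * thetaTerm a b ((j + 1 : ℕ) : ℤ) +
            gauss (a * b) I m j * thetaTerm a b (j : ℤ) * (a * (a * b) ^ m) := by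
        intro j hj
        have hj : j ≤ m := by simpa [Nat.lt_succ_iff] using hj
        have := thetaTerm_add_one a b (j : ℤ) (m := m) (l := m - j) (by omega)
        rw [gauss_succ hI hj]
        push_cast
        linear_combination (-gauss (a * b) I m j) * this
      rw [sum_congr rfl key, sum_add_distrib, ← sum_mul, sum_range_succ (fun j ↦
        gauss (a * b) I m (j + 1) * thetaTerm a b ((j + 1 : ℕ) : ℤ)) m,
        gauss_of_lt _ _ (Nat.lt_succ_self m), gauss_zero_right hI, gauss_zero_right hI,
        sum_range_succ' _ m, gauss_zero_right hI]
      ring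
  | succ n ih =>
    rw [prod_range_succ, ← mul_assoc, ih, mul_add, mul_one, ← add_assoc m n 1,
      sum_range_succ' _ (m + n + 1)]
    have key : ∀ j ∈ range (m + n + 1),
        gauss (a * b) I (m + n + 1) (j + 1) * thetaTerm a b ((j + 1 : ℕ) - (n + 1 : ℕ) : ℤ)
          = gauss (a * b) I (m + n) j * thetaTerm a b (j - n : ℤ) +
            gauss (a * b) I (m + n) (j + 1) * (a * b) ^ (j + 1) * thetaTerm a b (j - n : ℤ) := by
      intro j hj
      have hj : j ≤ m + n := by simpa [Nat.lt_succ_iff] using hj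
      rw [gauss_succ' hI hj]
      push_cast
      rw [show (j : ℤ) + 1 - (n + 1) = j - n by ring]
      ring
    have key2 : ∀ j ∈ range (m + n + 1),
        gauss (a * b) I (m + n) j * thetaTerm a b (j - n : ℤ) * (b * (a * b) ^ n)
          = gauss (a * b) I (m + n) j * (a * b) ^ j * thetaTerm a b (j - n - 1 : ℤ) := by
      intro j hj
      have := thetaTerm_sub_one a b (j - n : ℤ) (m := n) (l := j) (by omega)
      linear_combination (gauss (a * b) I (m + n) j) * this
    have key3 : ∑ j ∈ range (m + n + 1),
        gauss (a * b) I (m + n) j * (a * b) ^ j * thetaTerm a b (j - n - 1 : ℤ) =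
        ∑ j ∈ range (m + n + 1),
          gauss (a * b) I (m + n) (j + 1) * (a * b) ^ (j + 1) * thetaTerm a b (j - n : ℤ) +
        thetaTerm a b ((0 : ℕ) - (n + 1 : ℕ)) := by
      rw [sum_range_succ' _ (m + n), sum_range_succ _ (m + n),
        gauss_of_lt _ _ (Nat.lt_succ_self _), gauss_zero_right hI]
      simp only [zero_mul, add_zero, pow_zero, mul_one, one_mul]
      congr 1
      · refine sum_congr rfl fun j _ ↦ ?_
        push_cast
        rw [show (j : ℤ) + 1 - n - 1 = j - n by ring]
      · push_cast
        rw [show (0 : ℤ) - n - 1 = 0 - (n + 1) by ring]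
    rw [sum_congr rfl key, sum_add_distrib, sum_mul, sum_congr rfl key2, key3,
      gauss_zero_right hI]
    ring

end FiniteTripleProduct

/-! ### Passage to the limit: the Jacobi triple product -/

section TripleProduct

lemma X_pow_dvd_qPoch_sub {R : Type*} [CommRing R] {p x : R} (hp : x ∣ p) {r m : ℕ} (h : r ≤ m) :
    x ^ (r + 1) ∣ qPoch p m - qPoch p r := by
  induction m, h using Nat.le_induction with
  | base => simp
  | succ m hm ih =>
    rw [qPoch_succ, show qPoch p m * (1 - p ^ (m + 1)) - qPoch p r
      = (qPoch p m - qPoch p r) - qPoch p m * p ^ (m + 1) by ring]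
    exact dvd_sub ih (((pow_dvd_pow x (by omega)).trans (pow_dvd_pow_of_dvd hp _)).mul_left _)

lemma pow_dvd_thetaTerm {R : Type*} [CommRing R] {a b x : R} (h : x ∣ a * b) {d : ℕ} {k : ℤ}
    (hk : d + 2 ≤ |k|) : x ^ (d + 1) ∣ thetaTerm a b k := by
  have h1 : d + 1 ≤ tri k := by
    have := two_mul_tri k
    zify
    rcases abs_cases k with ⟨e, _⟩ | ⟨e, _⟩ <;> rw [e] at hk <;> nlinarith
  have h2 : d + 1 ≤ tri (-k) := by
    have := two_mul_tri (-k)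
    zify
    rcases abs_cases k with ⟨e, _⟩ | ⟨e, _⟩ <;> rw [e] at hk <;> nlinarith
  refine (pow_dvd_pow_of_dvd h _).trans ?_
  rw [mul_pow]
  exact mul_dvd_mul (pow_dvd_pow a h1) (pow_dvd_pow b h2)

lemma coeff_eq_of_X_pow_dvd_sub {u v : ℤ⟦X⟧} {d : ℕ} (h : X ^ (d + 1) ∣ u - v) :
    coeff d u = coeff d v := by
  have := X_pow_dvd_iff.mp h d (Nat.lt_succ_self d)
  rwa [map_sub, sub_eq_zero] at this

/-- The **Jacobi triple product identity** for formal power series. -/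
theorem triple_product {a b Fa Fb Fp : ℤ⟦X⟧} (hab : X ∣ a * b)
    (ha : HasProd (fun i : ℕ ↦ 1 + a * (a * b) ^ i) Fa)
    (hb : HasProd (fun i : ℕ ↦ 1 + b * (a * b) ^ i) Fb)
    (hp : HasProd (fun i : ℕ ↦ 1 - (a * b) ^ (i + 1)) Fp) :
    HasSum (thetaTerm a b) (Fa * Fb * Fp) := by
  set p := a * b with hpdef
  have hp0 : constantCoeff p = 0 := X_dvd_iff.mp hab
  have hc (m : ℕ) : constantCoeff (qPoch p m) = ((1 : ℤˣ) : ℤ) := by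
    simp [qPoch, map_prod, hp0]
  let I : ℕ → ℤ⟦X⟧ := fun m ↦ invOfUnit (qPoch p m) 1
  have hI (m : ℕ) : I m * qPoch p m = 1 := by
    rw [mul_comm]; exact mul_invOfUnit _ _ (hc m)
  have hlim : Tendsto (fun n ↦ (∏ i ∈ range n, (1 + a * p ^ i)) * (∏ i ∈ range n, (1 + b * p ^ i))
      * qPoch p n) atTop (𝓝 (Fa * Fb * Fp)) :=
    (ha.tendsto_prod_nat.mul hb.tendsto_prod_nat).mul hp.tendsto_prod_nat
  rw [WithPiTopology.tendsto_iff_coeff_tendsto] at hlim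
  rw [WithPiTopology.hasSum_iff_hasSum_coeff]
  intro d
  have hvan (k : ℤ) (hk : k ∉ Icc (-(d + 1) : ℤ) (d + 1)) : coeff d (thetaTerm a b k) = 0 := by
    refine X_pow_dvd_iff.mp (pow_dvd_thetaTerm hab ?_) d (Nat.lt_succ_self d)
    rw [mem_Icc, ← abs_le, not_le] at hk
    omega
  suffices h : coeff d (Fa * Fb * Fp) = ∑ k ∈ Icc (-(d + 1) : ℤ) (d + 1),
      coeff d (thetaTerm a b k) by
    rw [h]
    exact hasSum_sum_of_ne_finset_zero hvan
  have hev := hlim d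
  rw [nhds_discrete, tendsto_pure] at hev
  -- Coefficients are eventually constant. With `n ≥ 2 * d + 2`, every `j` with `|j - n| ≤ d + 1`
  -- has `j` and `2n - j` at least `d`, so all Pochhammer products in the Gaussian binomial agree
  -- modulo `X ^ (d + 1)`.
  obtain ⟨n, hn, hnd⟩ := (hev.and (eventually_ge_atTop (2 * d + 2))).exists
  rw [← hn, finite_triple_product hI, sum_mul, map_sum]
  have hterm : ∀ j ∈ range (n + n + 1),
      coeff d (gauss p I (n + n) j * thetaTerm a b (j - n) * qPoch p n)
        = coeff d (thetaTerm a b (j - n : ℤ)) := by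
    intro j hj
    rw [mem_range] at hj
    apply coeff_eq_of_X_pow_dvd_sub
    by_cases hk : ((j : ℤ) - n) ∈ Icc (-(d + 1) : ℤ) (d + 1)
    · rw [mem_Icc] at hk
      have hw : X ^ (d + 1) ∣ qPoch p n * gauss p I (n + n) j - 1 := by
        have e : qPoch p n * gauss p I (n + n) j - 1 = I j * I (n + n - j) *
            (((qPoch p n - qPoch p d) - (qPoch p j - qPoch p d)) * qPoch p (n + n) +
            qPoch p j * ((qPoch p (n + n) - qPoch p d) - (qPoch p (n + n - j) - qPoch p d))) := by
          rw [gauss, if_pos (by omega)]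
          have h1 := hI j
          have h2 := hI (n + n - j)
          linear_combination (I (n + n - j) * qPoch p (n + n - j)) * h1 + h2
        rw [e]
        refine Dvd.dvd.mul_left (dvd_add (Dvd.dvd.mul_right (dvd_sub ?_ ?_) _)
          (Dvd.dvd.mul_left (dvd_sub ?_ ?_) _)) _ <;>
          exact X_pow_dvd_qPoch_sub hab (by omega)
      rw [show gauss p I (n + n) j * thetaTerm a b (j - n : ℤ) * qPoch p n
        - thetaTerm a b (j - n : ℤ)
        = (qPoch p n * gauss p I (n + n) j - 1) * thetaTerm a b (j - n : ℤ) by ring]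
      exact hw.mul_right _
    · rw [mem_Icc, ← abs_le, not_le] at hk
      have ht : X ^ (d + 1) ∣ thetaTerm a b (j - n : ℤ) := pow_dvd_thetaTerm hab (by omega)
      exact dvd_sub ((ht.mul_left _).mul_right _) ht
  rw [sum_congr rfl hterm]
  have himg : ∑ j ∈ range (n + n + 1), coeff d (thetaTerm a b (j - n : ℤ))
      = ∑ k ∈ Icc (-n : ℤ) n, coeff d (thetaTerm a b k) := by
    refine sum_bij (fun j _ ↦ (j : ℤ) - n) ?_ ?_ ?_ ?_
    · intro j hj
      rw [mem_range] at hj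
      rw [mem_Icc]; omega
    · intro i _ j _ h
      have h : (i : ℤ) - n = j - n := h
      omega
    · intro k hk
      rw [mem_Icc] at hk
      exact ⟨(k + n).toNat, by rw [mem_range]; omega, by omega⟩
    · intros; rfl
  rw [himg]
  refine (sum_subset ?_ fun k _ hk ↦ hvan k hk).symm
  intro k hk
  rw [mem_Icc] at hk ⊢
  omega

end TripleProduct

/-! ### Splitting products and sums by residue class -/

section Residues

lemma hasProd_residues {k : ℕ} [NeZero k] {u : ℕ → ℤ⟦X⟧} {F : ℤ⟦X⟧} (hF : HasProd u F)
    {D : Fin k → ℤ⟦X⟧} (hD : ∀ r : Fin k, HasProd (fun i ↦ u (i * k + r)) (D r)) :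
    F = ∏ r, D r := by
  have h1 := ((Equiv.prodComm (Fin k) ℕ).trans (Nat.divModEquiv k).symm).hasProd_iff.mpr hF
  have h2 := h1.prod_fiberwise (g := D) fun r ↦ by
    simpa [Function.comp_def, Nat.divModEquiv] using hD r
  exact h2.unique (hasProd_fintype D)

lemma hasSum_residues_three {u : ℤ → ℤ⟦X⟧} {F F0 F1 F2 : ℤ⟦X⟧} (hF : HasSum u F)
    (h0 : HasSum (fun i ↦ u (3 * i)) F0) (h1 : HasSum (fun i ↦ u (3 * i + 1)) F1)
    (h2 : HasSum (fun i ↦ u (3 * i + 2)) F2) :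
    F = F0 + F1 + F2 := by
  have e1 := ((Equiv.prodComm (Fin 3) ℤ).trans (Int.divModEquiv 3).symm).hasSum_iff.mpr hF
  have e2 := e1.prod_fiberwise (g := ![F0, F1, F2]) fun r ↦ by
    fin_cases r
    · simpa [Function.comp_def, Int.divModEquiv, mul_comm] using h0
    · simpa [Function.comp_def, Int.divModEquiv, mul_comm] using h1
    · simpa [Function.comp_def, Int.divModEquiv, mul_comm] using h2
  rw [e2.unique (hasSum_fintype _), Fin.sum_univ_three]
  rfl

end Residues

/-! ### Products over arithmetic progressions -/

section Progressions

/-- The product `∏ (1 + c X ^ (k i + r))` over `i ≥ 0`. -/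
noncomputable def prog (c : ℤ) (k r : ℕ) : ℤ⟦X⟧ := ∏' i : ℕ, (1 + C c * X ^ (k * i + r))

lemma hasProd_prog (c : ℤ) (k r : ℕ) [NeZero k] :
    HasProd (fun i : ℕ ↦ 1 + C c * (X : ℤ⟦X⟧) ^ (k * i + r)) (prog c k r) := by
  refine Multipliable.hasProd (WithPiTopology.multipliable_one_add_of_tendsto_order_atTop_nhds_top ℤ
    (ENat.tendsto_nhds_top_iff_natCast_lt.mpr fun n ↦ eventually_atTop.mpr ⟨n + 1, fun m hm ↦ ?_⟩))
  refine lt_of_lt_of_le ?_ (le_order_mul ..)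
  rw [order_X_pow]
  refine lt_add_of_nonneg_of_lt (by simp) ?_
  have : 1 ≤ k := Nat.one_le_iff_ne_zero.mpr (NeZero.ne k)
  norm_cast
  nlinarith

lemma prog_split (c : ℤ) (k r m : ℕ) [NeZero k] [NeZero m] :
    prog c k r = ∏ s : Fin m, prog c (k * m) (r + k * s) := by
  refine hasProd_residues (hasProd_prog c k r) fun s ↦ ?_
  convert hasProd_prog c (k * m) (r + k * s) using 5
  ring

lemma prog_one_mul_prog_neg_one (k r : ℕ) [NeZero k] :
    prog 1 k r * prog (-1) k r = prog (-1) (2 * k) (2 * r) := by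
  refine ((hasProd_prog 1 k r).mul (hasProd_prog (-1) k r)).unique ?_
  convert hasProd_prog (-1) (2 * k) (2 * r) using 2 with i
  simp only [map_one, map_neg]
  ring

/-- The factor at `i = 0` is `1 + X ^ 0 = 2`. -/
lemma prog_one_zero : prog 1 1 0 = 2 * prog 1 1 1 := by
  have h := (hasProd_prog 1 1 1)
  have h2 := HasProd.zero_mul (f := fun i : ℕ ↦ 1 + C 1 * (X : ℤ⟦X⟧) ^ (1 * i + 0))
    (by simpa [mul_add] using h)
  rw [(hasProd_prog 1 1 0).unique h2]
  norm_num

lemma theta_eq_prog (c d : ℤ) (α β : ℕ) [NeZero (α + β)] (hcd : c * d = 1) :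
    HasSum (thetaTerm (C c * X ^ α) (C d * X ^ β))
      (prog c (α + β) α * prog d (α + β) β * prog (-1) (α + β) (α + β)) := by
  have e : (C c * X ^ α) * (C d * X ^ β) = (X : ℤ⟦X⟧) ^ (α + β) := by
    rw [mul_mul_mul_comm, ← map_mul, hcd, map_one, one_mul, pow_add]
  refine triple_product ?_ ?_ ?_ ?_
  · rw [e]
    exact dvd_pow_self _ (NeZero.ne _)
  · convert hasProd_prog c (α + β) α using 2 with i
    rw [e]; ring
  · convert hasProd_prog d (α + β) β using 2 with i
    rw [e]; ring
  · convert hasProd_prog (-1) (α + β) (α + β) using 2 with i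
    rw [e, map_neg, map_one]; ring

end Progressions

/-! ### Euler products and their inverses -/

section Euler

lemma continuous_expand {R : Type*} [CommRing R] [TopologicalSpace R] (k : ℕ) (hk : k ≠ 0) :
    Continuous (expand k hk : R⟦X⟧ → R⟦X⟧) := by
  rw [continuous_iff_continuousAt]
  intro a
  rw [ContinuousAt, WithPiTopology.tendsto_iff_coeff_tendsto]
  intro d
  simp only [coeff_expand]
  split_ifs
  · exact (WithPiTopology.continuous_coeff R _).tendsto a
  · exact tendsto_const_nhds

/-- The Euler product `∏ (1 - X ^ (k n))` over `n ≥ 1`. -/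
noncomputable def ef (k : ℕ) [NeZero k] : ℤ⟦X⟧ := expand k (NeZero.ne k) (pentagonalSeries ℤ)

/-- The inverse of the Euler product `ef k`. -/
noncomputable def eg (k : ℕ) [NeZero k] : ℤ⟦X⟧ := expand k (NeZero.ne k) (invOfUnit (ef 1) 1)

lemma expand_ef (j k l : ℕ) (hj : j ≠ 0) [NeZero k] [NeZero l] (h : j * k = l) :
    expand j hj (ef k) = ef l := by
  subst h
  exact (expand_mul _ _ _ _ _).symm

lemma expand_eg (j k l : ℕ) (hj : j ≠ 0) [NeZero k] [NeZero l] (h : j * k = l) :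
    expand j hj (eg k) = eg l := by
  subst h
  exact (expand_mul _ _ _ _ _).symm

lemma hasProd_ef (k : ℕ) [NeZero k] :
    HasProd (fun n : ℕ ↦ (1 : ℤ⟦X⟧) - X ^ (k * (n + 1))) (ef k) := by
  have h := (WithPiTopology.hasProd_one_sub_X_pow ℤ).map (expand k (NeZero.ne k))
    (continuous_expand k (NeZero.ne k))
  simpa [ef, Function.comp_def, ← pow_mul] using h

lemma ef_eq_prog (k : ℕ) [NeZero k] : ef k = prog (-1) k k := by
  refine (hasProd_ef k).unique ?_
  convert hasProd_prog (-1) k k using 2 with i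
  rw [map_neg, map_one]; ring

lemma constantCoeff_ef (k : ℕ) [NeZero k] : constantCoeff (ef k) = 1 := by
  have h := (hasProd_ef k).map (constantCoeff (R := ℤ)) (WithPiTopology.continuous_constantCoeff ℤ)
  refine h.unique ?_
  convert hasProd_one with i
  simp [NeZero.ne k]

lemma ef_mul_eg (k : ℕ) [NeZero k] : ef k * eg k = 1 := by
  have h : ef 1 * eg 1 = 1 := by
    rw [eg]
    simp only [expand_one_apply]
    exact mul_invOfUnit _ _ (by simp [constantCoeff_ef])
  rw [← expand_ef k 1 k (NeZero.ne k) (mul_one k), ← expand_eg k 1 k (NeZero.ne k) (mul_one k),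
    ← map_mul, h, map_one]

end Euler

/-! ### Theta series as eta quotients -/

section Products

lemma prog_split_two (c : ℤ) (k r : ℕ) [NeZero k] :
    prog c k r = prog c (k * 2) r * prog c (k * 2) (r + k) := by
  rw [prog_split c k r 2, Fin.prod_univ_two]; simp

lemma prog_split_three (c : ℤ) (k r : ℕ) [NeZero k] :
    prog c k r = prog c (k * 3) r * prog c (k * 3) (r + k) * prog c (k * 3) (r + k * 2) := by
  rw [prog_split c k r 3, Fin.prod_univ_three]; simp

lemma ef_split_two : ef 1 = prog (-1) 2 1 * ef 2 := by
  rw [ef_eq_prog, prog_split_two, ef_eq_prog]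

lemma ef_split_six : ef 1 = prog (-1) 6 1 * prog (-1) 6 2 * prog (-1) 6 3 * prog (-1) 6 4 *
    prog (-1) 6 5 * ef 6 := by
  rw [ef_eq_prog, prog_split_two, prog_split_three, prog_split_three _ _ (1 + 1), ef_eq_prog]
  ring

lemma ef_two_split : ef 2 = prog (-1) 6 2 * prog (-1) 6 4 * ef 6 := by
  rw [ef_eq_prog, prog_split_three, ef_eq_prog]

lemma ef_three_split : ef 3 = prog (-1) 6 3 * ef 6 := by
  rw [ef_eq_prog, prog_split_two, ef_eq_prog]

lemma ef_one_split_three : ef 1 = prog (-1) 3 1 * prog (-1) 3 2 * ef 3 := by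
  rw [ef_eq_prog, prog_split_three, ef_eq_prog]

lemma hasSum_phi : HasSum (thetaTerm (-X) (-X : ℤ⟦X⟧)) (ef 1 ^ 2 * eg 2) := by
  convert theta_eq_prog (-1) (-1) 1 1 (by norm_num) using 1
  · simp
  · have h := ef_mul_eg 2
    have h2 := ef_eq_prog 2
    have h3 := ef_split_two
    norm_num
    rw [← h2, h3]
    linear_combination (prog (-1) 2 1 ^ 2 * ef 2) * h

lemma hasSum_omega : HasSum (thetaTerm (-X ^ 5) (-X : ℤ⟦X⟧)) (ef 1 * ef 6 ^ 2 * eg 2 * eg 3) := by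
  convert theta_eq_prog (-1) (-1) 5 1 (by norm_num) using 1
  · simp
  · have e2 := ef_mul_eg 2
    have e3 := ef_mul_eg 3
    norm_num
    rw [← ef_eq_prog 6]
    calc ef 1 * ef 6 ^ 2 * eg 2 * eg 3
        = prog (-1) 6 5 * prog (-1) 6 1 * ef 6 * ((prog (-1) 6 2 * prog (-1) 6 4 * ef 6) * eg 2) *
          ((prog (-1) 6 3 * ef 6) * eg 3) := by rw [ef_split_six]; ring
      _ = _ := by rw [← ef_two_split, ← ef_three_split, e2, e3]; ring

lemma hasSum_pent : HasSum (thetaTerm (X ^ 2) (X : ℤ⟦X⟧)) (ef 2 * ef 3 ^ 2 * eg 1 * eg 6) := by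
  convert theta_eq_prog 1 1 2 1 (by norm_num) using 1
  · simp
  · have e1 := ef_mul_eg 1
    have e6 := ef_mul_eg 6
    have h1 := prog_one_mul_prog_neg_one 3 1
    have h2 := prog_one_mul_prog_neg_one 3 2
    norm_num at h1 h2 ⊢
    rw [← ef_eq_prog 3]
    calc ef 2 * ef 3 ^ 2 * eg 1 * eg 6
        = (prog 1 3 2 * prog 1 3 1 * ef 3) * ((prog (-1) 3 1 * prog (-1) 3 2 * ef 3) * eg 1) *
          (ef 6 * eg 6) := by rw [ef_two_split, ← h1, ← h2]; ring
      _ = _ := by rw [← ef_one_split_three, e1, e6]; ring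

/-- The factor 2 appears because the sum runs over all integers and `k`, `-k - 1` give the same
triangular number. -/
lemma hasSum_psi : HasSum (thetaTerm X (1 : ℤ⟦X⟧)) (2 * (ef 2 ^ 2 * eg 1)) := by
  convert theta_eq_prog 1 1 1 0 (by norm_num) using 1
  · simp
  · have e1 := ef_mul_eg 1
    have h1 : prog 1 1 1 * ef 1 = ef 2 := by
      rw [ef_eq_prog, prog_one_mul_prog_neg_one, ef_eq_prog]
    norm_num
    rw [← ef_eq_prog 1, prog_one_zero, ← h1]
    linear_combination (2 * prog 1 1 1 ^ 2 * ef 1) * e1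

end Products

/-! ### The 3-dissections of φ(-q) and ψ(q) -/

section Dissections

lemma expand_thetaTerm {R : Type*} [CommRing R] (n : ℕ) (hn : n ≠ 0) (a b : R⟦X⟧) (k : ℤ) :
    expand n hn (thetaTerm a b k) = thetaTerm (expand n hn a) (expand n hn b) k := by
  simp [thetaTerm]

lemma hasSum_expand {t : ℤ → ℤ⟦X⟧} {S : ℤ⟦X⟧} (n : ℕ) (hn : n ≠ 0) (h : HasSum t S) :
    HasSum (fun k ↦ expand n hn (t k)) (expand n hn S) :=
  h.map (expand n hn) (continuous_expand n hn)

lemma hasSum_neg_sub_one {t : ℤ → ℤ⟦X⟧} {S : ℤ⟦X⟧} (h : HasSum t S) :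
    HasSum (fun k ↦ t (-k - 1)) S :=
  (((Equiv.neg ℤ).trans (Equiv.subRight 1)).hasSum_iff (f := t)).mpr h

/-- The 3-dissection of `φ(-q)`. -/
lemma phi_dissection : ef 1 ^ 2 * eg 2 =
    ef 9 ^ 2 * eg 18 - 2 * X * (ef 3 * ef 18 ^ 2 * eg 6 * eg 9) := by
  have hφ := hasSum_expand 9 (by norm_num) hasSum_phi
  have hΩ := (hasSum_expand 3 (by norm_num) hasSum_omega).mul_left (-X)
  have hΩ' := hasSum_neg_sub_one hΩ
  simp only [map_mul, map_pow, expand_ef 9 1 9 _ rfl, expand_eg 9 2 18 _ rfl, expand_ef 3 1 3 _ rfl,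
    expand_ef 3 6 18 _ rfl, expand_eg 3 2 6 _ rfl, expand_eg 3 3 9 _ rfl, expand_thetaTerm, map_neg,
    expand_X] at hφ hΩ hΩ'
  have e9 : (-X ^ 9 : ℤ⟦X⟧) = (-X) ^ 9 := by ring
  have e15 : (-(X ^ 3) ^ 5 : ℤ⟦X⟧) = (-X) ^ 15 := by ring
  have e3 : (-X ^ 3 : ℤ⟦X⟧) = (-X) ^ 3 := by ring
  rw [e9] at hφ
  rw [e15, e3] at hΩ hΩ'
  -- Indices `3k` give φ(-q⁹); `3k + 1` and `3k + 2` give the same series, the latter after the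
  -- reflection `k ↦ -k - 1`.
  have key := hasSum_residues_three hasSum_phi
    (by
      convert hφ using 2 with k
      simp only [thetaTerm, ← pow_add, ← pow_mul]
      congr 1
      have h1 := two_mul_tri (3 * k)
      have h2 := two_mul_tri (-(3 * k))
      have h3 := two_mul_tri k
      have h4 := two_mul_tri (-k)
      zify; linarith)
    (by
      convert hΩ using 2 with k
      · rfl
      simp only [thetaTerm, ← pow_add, ← pow_mul, ← pow_succ']
      congr 1
      have h1 := two_mul_tri (3 * k + 1)
      have h2 := two_mul_tri (-(3 * k + 1))
      have h3 := two_mul_tri k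
      have h4 := two_mul_tri (-k)
      zify; linarith)
    (by
      convert hΩ' using 2 with k
      simp only [thetaTerm, ← pow_add, ← pow_mul, ← pow_succ']
      congr 1
      have h1 := two_mul_tri (3 * k + 2)
      have h2 := two_mul_tri (-(3 * k + 2))
      have h3 := two_mul_tri (-k - 1)
      have h4 := two_mul_tri (-(-k - 1))
      zify; linarith)
  rw [key]; ring

/-- The 3-dissection of `ψ(q)`. -/
lemma psi_dissection : ef 2 ^ 2 * eg 1 =
    ef 6 * ef 9 ^ 2 * eg 3 * eg 18 + X * (ef 18 ^ 2 * eg 9) := by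
  have hA := hasSum_expand 3 (by norm_num) hasSum_pent
  have hA' := hasSum_neg_sub_one hA
  have hψ := (hasSum_expand 9 (by norm_num) hasSum_psi).mul_left X
  simp only [map_mul, map_pow, expand_ef 3 2 6 _ rfl, expand_eg 3 1 3 _ rfl, expand_ef 3 3 9 _ rfl,
    expand_ef 9 2 18 _ rfl, expand_eg 3 6 18 _ rfl, expand_eg 9 1 9 _ rfl, expand_thetaTerm,
    map_one, expand_X, map_ofNat] at hA hA' hψ
  have key := hasSum_residues_three hasSum_psi
    (by
      convert hA using 2 with k
      simp only [thetaTerm, ← pow_add, ← pow_mul, one_pow, mul_one]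
      congr 1
      have h1 := two_mul_tri (3 * k)
      have h3 := two_mul_tri k
      have h4 := two_mul_tri (-k)
      zify; linarith)
    (by
      convert hψ using 2 with k
      · rfl
      simp only [thetaTerm, ← pow_mul, one_pow, mul_one, ← pow_succ']
      congr 1
      have h1 := two_mul_tri (3 * k + 1)
      have h3 := two_mul_tri k
      zify; linarith)
    (by
      convert hA' using 2 with k
      simp only [thetaTerm, ← pow_add, ← pow_mul, one_pow, mul_one]
      congr 1
      have h1 := two_mul_tri (3 * k + 2)
      have h3 := two_mul_tri (-k - 1)
      have h4 := two_mul_tri (-(-k - 1))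
      zify; linarith)
  have h2 : (2 : ℤ⟦X⟧) ≠ 0 := fun h ↦ by
    have h0 := congrArg (constantCoeff (R := ℤ)) h
    rw [map_ofNat] at h0
    norm_num at h0
  refine mul_left_cancel₀ h2 ?_
  rw [key]; ring

end Dissections

/-! ### Norms over the cube roots of unity -/

section Norm

lemma continuous_rescale {R : Type*} [CommRing R] [TopologicalSpace R] [IsTopologicalRing R]
    (a : R) : Continuous (rescale a : R⟦X⟧ → R⟦X⟧) := by
  rw [continuous_iff_continuousAt]
  intro g
  rw [ContinuousAt, WithPiTopology.tendsto_iff_coeff_tendsto]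
  intro d
  simp only [coeff_rescale]
  exact ((WithPiTopology.continuous_coeff R d).tendsto g).const_mul _

lemma continuous_map_intCast {R : Type*} [CommRing R] [TopologicalSpace R] :
    Continuous (PowerSeries.map (Int.castRingHom R)) := by
  rw [continuous_iff_continuousAt]
  intro g
  rw [ContinuousAt, WithPiTopology.tendsto_iff_coeff_tendsto]
  intro d
  simp only [coeff_map]
  exact (continuous_of_discreteTopology.tendsto _).comp
    ((WithPiTopology.continuous_coeff ℤ d).tendsto g)

lemma rescale_X {R : Type*} [CommRing R] (a : R) : rescale a (X : R⟦X⟧) = C a * X := by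
  ext n
  rw [coeff_rescale, coeff_C_mul, coeff_X]
  split_ifs with h
  · simp [h]
  · simp

lemma rescale_expand_of_pow_eq_one {R : Type*} [CommRing R] {a : R} {k : ℕ} (hk : k ≠ 0)
    (ha : a ^ k = 1) (g : R⟦X⟧) : rescale a (expand k hk g) = expand k hk g := by
  ext n
  rw [coeff_rescale, coeff_expand]
  split_ifs with h
  · obtain ⟨m, rfl⟩ := h
    rw [pow_mul, ha, one_pow, one_mul]
  · rw [mul_zero]

lemma rescale_expand_two {R : Type*} [CommRing R] (a : R) (g : R⟦X⟧) :
    rescale a (expand 2 two_ne_zero g) = expand 2 two_ne_zero (rescale (a ^ 2) g) := by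
  ext n
  simp only [coeff_rescale, coeff_expand]
  split_ifs with h
  · obtain ⟨m, rfl⟩ := h
    rw [pow_mul, Nat.mul_div_cancel_left _ two_pos]
  · rw [mul_zero]

lemma hasProd_multiples {v : ℕ → ℂ⟦X⟧} {F : ℂ⟦X⟧} (h : HasProd (fun m ↦ v (3 * (m + 1))) F) :
    HasProd (fun n ↦ if 3 ∣ n + 1 then v (n + 1) else 1) F := by
  have hinj : Function.Injective (fun m : ℕ ↦ 3 * m + 2) := fun a b hab ↦ by
    have : 3 * a + 2 = 3 * b + 2 := hab
    omega
  refine (hinj.hasProd_iff ?_).mp ?_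
  · intro n hn
    refine if_neg fun ⟨m, hm⟩ ↦ hn ⟨m - 1, ?_⟩
    change 3 * (m - 1) + 2 = n
    omega
  · convert h using 2 with m
    simp only [Function.comp_apply]
    rw [if_pos ⟨m + 1, by ring⟩, show 3 * m + 2 + 1 = 3 * (m + 1) by ring]

/-- The Euler product `ef k`, viewed over the complex numbers. -/
noncomputable def efc (k : ℕ) [NeZero k] : ℂ⟦X⟧ := PowerSeries.map (Int.castRingHom ℂ) (ef k)

lemma hasProd_efc (k : ℕ) [NeZero k] :
    HasProd (fun n : ℕ ↦ (1 : ℂ⟦X⟧) - X ^ (k * (n + 1))) (efc k) := by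
  have h := (hasProd_ef k).map (PowerSeries.map (Int.castRingHom ℂ)) continuous_map_intCast
  simpa [efc, Function.comp_def] using h

lemma expand_efc (j k l : ℕ) (hj : j ≠ 0) [NeZero k] [NeZero l] (h : j * k = l) :
    expand j hj (efc k) = efc l := by
  rw [efc, ← map_expand, expand_ef j k l hj h, efc]

/-- Compare factors: the product of `1 - ω ^ (j n) X ^ n` over `j = 0, 1, 2` is `1 - X ^ (3 n)` if
`3 ∤ n` and `(1 - X ^ n) ^ 3` otherwise. The factor `efc 9` supplies the `1 - X ^ (3 n)` missing for
`3 ∣ n`. -/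
lemma norm_efc_one {ω : ℂ} (hω : 1 + ω + ω ^ 2 = 0) :
    efc 1 * rescale ω (efc 1) * rescale (ω ^ 2) (efc 1) * efc 9 = efc 3 ^ 4 := by
  have hω3 : ω ^ 3 = 1 := by linear_combination (ω - 1) * hω
  have h1 := hasProd_efc 1
  have hr (a : ℂ) : HasProd (fun n : ℕ ↦ (1 : ℂ⟦X⟧) - (C a * X) ^ (n + 1)) (rescale a (efc 1)) := by
    have h := h1.map (rescale a) (continuous_rescale a)
    simpa [Function.comp_def, rescale_X] using h
  have h9 := hasProd_multiples (v := fun n ↦ 1 - X ^ (3 * n)) (F := efc 9) (by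
    convert hasProd_efc 9 using 4; ring)
  have h3 := hasProd_efc 3
  have h3' := hasProd_multiples (v := fun n ↦ 1 - X ^ n) h3
  have hL := ((h1.mul (hr ω)).mul (hr (ω ^ 2))).mul h9
  have hR := ((h3.mul h3').mul h3').mul h3'
  rw [show efc 3 ^ 4 = efc 3 * efc 3 * efc 3 * efc 3 by ring]
  refine hL.unique ?_
  convert hR using 2 with n
  rw [mul_pow, mul_pow, one_mul, ← map_pow, ← map_pow]
  split_ifs with h
  · obtain ⟨m, hm⟩ := h
    rw [hm, ← pow_mul, show 2 * (3 * m) = 3 * (2 * m) by ring, pow_mul ω, pow_mul ω, hω3, one_pow,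
      one_pow, map_one]
    ring
  · have hz : 1 + ω ^ (n + 1) + ω ^ (2 * (n + 1)) = 0 := by
      have hmod : (n + 1) % 3 = 1 ∨ (n + 1) % 3 = 2 := by omega
      have e1 : ω ^ (n + 1) = ω ^ ((n + 1) % 3) := by
        conv_lhs => rw [← Nat.div_add_mod (n + 1) 3, pow_add, pow_mul, hω3, one_pow, one_mul]
      rw [mul_comm 2, pow_mul, e1]
      rcases hmod with h | h <;> rw [h]
      · linear_combination hω
      · linear_combination hω + ω * hω3
    have hz3 : ω ^ (n + 1) * ω ^ (2 * (n + 1)) = 1 := by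
      rw [← pow_add, show n + 1 + 2 * (n + 1) = 3 * (n + 1) by ring, pow_mul, hω3, one_pow]
    have hz' := congrArg (C (R := ℂ)) hz
    have hz3' := congrArg (C (R := ℂ)) hz3
    rw [map_add, map_add, map_one, map_zero] at hz'
    rw [map_mul, map_one] at hz3'
    rw [← pow_mul ω 2, mul_comm 3 (n + 1), pow_mul X (n + 1) 3]
    linear_combination (-X ^ (n + 1) + X ^ (2 * (n + 1))) * hz' +
      (X ^ (2 * (n + 1)) - X ^ (3 * (n + 1))) * hz3'

lemma norm_efc_two {ω : ℂ} (hω : 1 + ω + ω ^ 2 = 0) :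
    efc 2 * rescale ω (efc 2) * rescale (ω ^ 2) (efc 2) * efc 18 = efc 6 ^ 4 := by
  have hω3 : ω ^ 3 = 1 := by linear_combination (ω - 1) * hω
  have h := congrArg (expand 2 two_ne_zero) (norm_efc_one hω)
  simp only [map_mul, map_pow, expand_efc 2 1 2 _ rfl, expand_efc 2 3 6 _ rfl,
    expand_efc 2 9 18 _ rfl] at h
  rw [← h, ← expand_efc 2 1 2 two_ne_zero rfl, rescale_expand_two, rescale_expand_two,
    show (ω ^ 2) ^ 2 = ω by linear_combination ω * hω3]
  ring

/-- The Hauptmodul quotient `f₂ f₃³ / (f₁ f₆³)`. -/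
noncomputable def tq : ℤ⟦X⟧ := ef 2 * ef 3 ^ 3 * eg 1 * eg 6 ^ 3

/-- The dissection of ψ reads `T + X` times a series in q³, with `T = tq(q³)`. Multiplying its
images under `X ↦ ω ^ j X` turns `T + X` into `T ^ 3 + X ^ 3`, and the other side is evaluated by
`norm_efc_one` and `norm_efc_two`. Then q³ is replaced by q. -/
theorem tq_cube_add_X : tq ^ 3 + X = ef 2 ^ 8 * ef 3 ^ 4 * eg 1 ^ 4 * eg 6 ^ 8 := by
  obtain ⟨ω, hω⟩ : ∃ ω : ℂ, 1 + ω + ω ^ 2 = 0 := by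
    have h := (Complex.isPrimitiveRoot_exp 3 (by norm_num)).geom_sum_eq_zero (by norm_num)
    refine ⟨_, by simpa [sum_range_succ] using h⟩
  have hω3 : ω ^ 3 = 1 := by linear_combination (ω - 1) * hω
  have n1 := norm_efc_one hω
  have n2 := norm_efc_two hω
  let m := PowerSeries.map (Int.castRingHom ℂ)
  let T := expand 3 three_ne_zero (m tq)
  have hψ : efc 2 ^ 2 * efc 9 = efc 18 ^ 2 * (T + X) * efc 1 := by
    have h1 := ef_mul_eg 1
    have h3 := ef_mul_eg 3
    have h9 := ef_mul_eg 9
    have h18 := ef_mul_eg 18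
    have hd := psi_dissection
    have ht : expand 3 three_ne_zero tq = ef 6 * ef 9 ^ 3 * eg 3 * eg 18 ^ 3 := by
      simp only [tq, map_mul, map_pow, expand_ef 3 2 6 _ rfl, expand_ef 3 3 9 _ rfl,
        expand_eg 3 1 3 _ rfl, expand_eg 3 6 18 _ rfl]
    have hz : ef 2 ^ 2 * ef 9 = ef 18 ^ 2 * (expand 3 three_ne_zero tq + X) * ef 1 := by
      rw [ht]
      have e1 : ef 2 ^ 2 * ef 9 = (ef 2 ^ 2 * eg 1) * ef 1 * ef 9 := by
        linear_combination (-ef 2 ^ 2 * ef 9) * h1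
      rw [e1, hd]
      linear_combination (X * ef 18 ^ 2 * ef 1) * h9 -
        (ef 6 * ef 9 ^ 3 * eg 3 * ef 1 * eg 18 * (ef 18 * eg 18 + 1)) * h18
    have := congrArg m hz
    simpa [m, T, efc, map_expand] using this
  have hfix (a : ℂ) (ha : a ^ 3 = 1) (g : ℂ⟦X⟧) :
      rescale a (expand 3 three_ne_zero g) = expand 3 three_ne_zero g :=
    rescale_expand_of_pow_eq_one _ ha g
  have hψa (a : ℂ) (ha : a ^ 3 = 1) : rescale a (efc 2) ^ 2 * efc 9 =
      efc 18 ^ 2 * (T + C a * X) * rescale a (efc 1) := by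
    have h := congrArg (rescale a) hψ
    rw [← expand_efc 3 3 9 three_ne_zero rfl, ← expand_efc 3 6 18 three_ne_zero rfl] at h
    simp only [map_mul, map_pow, map_add, rescale_X, T, hfix a ha] at h
    rwa [expand_efc 3 3 9 three_ne_zero rfl, expand_efc 3 6 18 three_ne_zero rfl] at h
  have hψ1 := hψa ω hω3
  have hψ2 := hψa (ω ^ 2) (by linear_combination (ω ^ 3 + 1) * hω3)
  have hT : (T + X) * (T + C ω * X) * (T + C (ω ^ 2) * X) = T ^ 3 + X ^ 3 := by
    have c1 := congrArg (C (R := ℂ)) hω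
    have c3 := congrArg (C (R := ℂ)) hω3
    simp only [map_add, map_one, map_pow, map_zero] at c1 c3
    rw [map_pow]
    linear_combination (T ^ 2 * X + T * X ^ 2 * C ω) * c1 + X ^ 3 * c3
  have main : (T ^ 3 + X ^ 3) * (efc 18 ^ 8 * efc 3 ^ 4) = efc 6 ^ 8 * efc 9 ^ 4 := by
    have hprod : (efc 2 * rescale ω (efc 2) * rescale (ω ^ 2) (efc 2)) ^ 2 * efc 9 ^ 3 =
        efc 18 ^ 6 * (T ^ 3 + X ^ 3) *
          (efc 1 * rescale ω (efc 1) * rescale (ω ^ 2) (efc 1)) := by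
      rw [← hT]
      calc _ = (efc 2 ^ 2 * efc 9) * (rescale ω (efc 2) ^ 2 * efc 9) *
          (rescale (ω ^ 2) (efc 2) ^ 2 * efc 9) := by ring
        _ = _ := by rw [hψ, hψ1, hψ2]; ring
    linear_combination (-(T ^ 3 + X ^ 3) * efc 18 ^ 8) * n1 - (efc 18 ^ 2 * efc 9) * hprod +
      efc 9 ^ 4 * (efc 2 * rescale ω (efc 2) * rescale (ω ^ 2) (efc 2) * efc 18 + efc 6 ^ 4) * n2
  have hinj : Function.Injective (fun g : ℤ⟦X⟧ ↦ expand 3 three_ne_zero (m g)) := by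
    intro a b hab
    ext n
    have h := congrArg (coeff (3 * n)) hab
    simpa [m] using h
  have hcleared : (tq ^ 3 + X) * (ef 6 ^ 8 * ef 1 ^ 4) = ef 2 ^ 8 * ef 3 ^ 4 := by
    apply hinj
    have e (k : ℕ) [NeZero k] : m (ef k) = efc k := rfl
    have eX : m X = X := map_X _
    simp only [map_mul, map_add, map_pow, e, eX, expand_efc 3 6 18 _ rfl, expand_efc 3 1 3 _ rfl,
      expand_efc 3 2 6 _ rfl, expand_efc 3 3 9 _ rfl, expand_X]
    exact main
  have h1 : ef 1 ^ 4 * eg 1 ^ 4 = 1 := by rw [← mul_pow, ef_mul_eg, one_pow]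
  have h6 : ef 6 ^ 8 * eg 6 ^ 8 = 1 := by rw [← mul_pow, ef_mul_eg, one_pow]
  linear_combination (eg 1 ^ 4 * eg 6 ^ 8) * hcleared - (tq ^ 3 + X) * (ef 6 ^ 8 * eg 6 ^ 8) * h1 -
    (tq ^ 3 + X) * h6

end Norm

/-! ### Extracting residue classes of coefficients -/

section Sections
variable {R : Type*} [CommRing R]

/-- The series `∑ a (3 n + i) X ^ n` extracted from `∑ a n X ^ n`. -/
noncomputable def sect (i : ℕ) : R⟦X⟧ →ₗ[R] R⟦X⟧ where
  toFun g := mk fun n ↦ coeff (3 * n + i) g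
  map_add' g h := by ext; simp
  map_smul' c g := by ext; simp

@[simp]
lemma coeff_sect (i n : ℕ) (g : R⟦X⟧) : coeff n (sect i g) = coeff (3 * n + i) g := by
  simp [sect]

lemma sect_X_pow_mul_expand {i j : ℕ} (hi : i < 3) (hj : j < 3) (g : R⟦X⟧) :
    sect i (X ^ j * expand 3 three_ne_zero g) = if i = j then g else 0 := by
  ext n
  rw [coeff_sect, coeff_X_pow_mul']
  split_ifs with h1 h2 h2
  · rw [h2, Nat.add_sub_cancel, coeff_expand_mul]
  · rw [coeff_expand_of_not_dvd _ _ _ (by omega), map_zero]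
  · omega
  · rw [map_zero]

lemma eq_sect_add (g : R⟦X⟧) : g = expand 3 three_ne_zero (sect 0 g) +
    X * expand 3 three_ne_zero (sect 1 g) + X ^ 2 * expand 3 three_ne_zero (sect 2 g) := by
  ext n
  have e1 : coeff n (X * expand 3 three_ne_zero (sect 1 g)) =
      coeff n (X ^ 1 * expand 3 three_ne_zero (sect 1 g)) := by rw [pow_one]
  rw [map_add, map_add, e1, coeff_X_pow_mul', coeff_X_pow_mul']
  obtain ⟨m, rfl | rfl | rfl⟩ : ∃ m, n = 3 * m ∨ n = 3 * m + 1 ∨ n = 3 * m + 2 :=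
    ⟨n / 3, by omega⟩
  · have h1 : ¬ (3 ∣ 3 * m - 1 ∧ 1 ≤ 3 * m) := by omega
    have h2 : ¬ (3 ∣ 3 * m - 2 ∧ 2 ≤ 3 * m) := by omega
    rw [coeff_expand_mul, coeff_sect, coeff_expand, coeff_expand]
    split_ifs <;> first | (exfalso; omega) | simp
  · rw [coeff_expand_of_not_dvd _ _ _ (by omega), if_pos (by omega), Nat.add_sub_cancel,
      coeff_expand_mul, coeff_sect, coeff_expand]
    split_ifs <;> first | (exfalso; omega) | simp
  · rw [coeff_expand_of_not_dvd _ _ _ (by omega), if_pos (by omega), if_pos (by omega),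
      Nat.add_sub_cancel, coeff_expand_mul, coeff_sect,
      coeff_expand_of_not_dvd (m := 3 * m + 2 - 1) _ _ _ (by omega)]
    simp

lemma sect_of_eq {g a b c : R⟦X⟧} (h : g = expand 3 three_ne_zero a +
    X * expand 3 three_ne_zero b + X ^ 2 * expand 3 three_ne_zero c) :
    sect 0 g = a ∧ sect 1 g = b ∧ sect 2 g = c := by
  have e0 := fun i (hi : i < 3) ↦ sect_X_pow_mul_expand (R := R) hi (show 0 < 3 by norm_num) a
  have e1 := fun i (hi : i < 3) ↦ sect_X_pow_mul_expand (R := R) hi (show 1 < 3 by norm_num) b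
  have e2 := fun i (hi : i < 3) ↦ sect_X_pow_mul_expand (R := R) hi (show 2 < 3 by norm_num) c
  simp only [pow_zero, one_mul, pow_one] at e0 e1
  refine ⟨?_, ?_, ?_⟩ <;> rw [h, map_add, map_add, e0 _ (by norm_num), e1 _ (by norm_num),
    e2 _ (by norm_num)] <;> simp

lemma sect_expand_mul {i : ℕ} (hi : i < 3) (g h : R⟦X⟧) :
    sect i (expand 3 three_ne_zero g * h) = g * sect i h := by
  have key := sect_of_eq (g := expand 3 three_ne_zero g * h) (a := g * sect 0 h)
    (b := g * sect 1 h) (c := g * sect 2 h) (by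
      simp only [map_mul]
      linear_combination (expand 3 three_ne_zero g) * eq_sect_add h)
  interval_cases i
  exacts [key.1, key.2.1, key.2.2]

lemma sect_ofNat_mul (i n : ℕ) (h : R⟦X⟧) : sect i ((n : R⟦X⟧) * h) = (n : R⟦X⟧) * sect i h := by
  rw [← nsmul_eq_mul, map_nsmul, nsmul_eq_mul]

lemma sect_succ_X_mul (i : ℕ) (h : R⟦X⟧) : sect (i + 1) (X * h) = sect i h := by
  ext n
  rw [coeff_sect, coeff_sect, ← add_assoc, coeff_succ_X_mul]

lemma natCast_dvd_sect {n i : ℕ} {g : R⟦X⟧} (h : (n : R⟦X⟧) ∣ g) : (n : R⟦X⟧) ∣ sect i g := by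
  obtain ⟨z, rfl⟩ := h
  exact ⟨sect i z, sect_ofNat_mul i n z⟩

lemma map_sect {S : Type*} [CommRing S] (m : R →+* S) (i : ℕ) (g : R⟦X⟧) :
    PowerSeries.map m (sect i g) = sect i (PowerSeries.map m g) := by
  ext n; simp

end Sections

/-! ### Eta quotients modulo 3 -/

section ModThree

/-- Reduction modulo 3 of integral power series. -/
noncomputable def red3 : ℤ⟦X⟧ →+* (ZMod 3)⟦X⟧ := PowerSeries.map (Int.castRingHom (ZMod 3))

lemma three_eq_zero : (3 : (ZMod 3)⟦X⟧) = 0 := by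
  rw [← map_ofNat (C (R := ZMod 3)) 3, show (OfNat.ofNat 3 : ZMod 3) = 0 from rfl, map_zero]

lemma three_dvd_iff_red3 (g : ℤ⟦X⟧) : 3 ∣ g ↔ red3 g = 0 := by
  constructor
  · rintro ⟨z, rfl⟩
    rw [map_mul, map_ofNat, three_eq_zero, zero_mul]
  · intro h
    have hd (n : ℕ) : (3 : ℤ) ∣ coeff n g := by
      have h1 := congrArg (coeff n) h
      rw [red3, coeff_map, map_zero] at h1
      exact (ZMod.intCast_zmod_eq_zero_iff_dvd _ 3).mp h1
    choose z hz using hd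
    refine ⟨PowerSeries.mk z, ?_⟩
    ext n
    rw [hz, ← map_ofNat (C (R := ℤ)) 3, coeff_C_mul, coeff_mk]

lemma three_dvd_sub_iff (g h : ℤ⟦X⟧) : 3 ∣ g - h ↔ red3 g = red3 h := by
  rw [three_dvd_iff_red3, map_sub, sub_eq_zero]

lemma expand_three_eq_pow (g : (ZMod 3)⟦X⟧) : expand 3 three_ne_zero g = g ^ 3 := by
  have h := MvPowerSeries.map_frobenius_expand (p := 3) (R := ZMod 3) three_ne_zero (f := g)
  rw [ZMod.frobenius_zmod] at h
  simpa [PowerSeries.expand] using h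

/-- The Euler product `ef k` modulo 3. -/
noncomputable def uf (k : ℕ) [NeZero k] : (ZMod 3)⟦X⟧ := red3 (ef k)

/-- The inverse of the Euler product `ef k` modulo 3. -/
noncomputable def ug (k : ℕ) [NeZero k] : (ZMod 3)⟦X⟧ := red3 (eg k)

lemma red3_ef (k : ℕ) [NeZero k] : red3 (ef k) = uf k := rfl

lemma red3_eg (k : ℕ) [NeZero k] : red3 (eg k) = ug k := rfl

lemma red3_X : red3 X = X := map_X _

lemma uf_mul_ug (k : ℕ) [NeZero k] : uf k * ug k = 1 := by
  rw [uf, ug, ← map_mul, ef_mul_eg, map_one]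

lemma uf_three_mul (k l : ℕ) [NeZero k] [NeZero l] (h : 3 * k = l) : uf l = uf k ^ 3 := by
  rw [uf, ← expand_ef 3 k l three_ne_zero h, red3, map_expand, expand_three_eq_pow]; rfl

lemma ug_three_mul (k l : ℕ) [NeZero k] [NeZero l] (h : 3 * k = l) : ug l = ug k ^ 3 := by
  rw [ug, ← expand_eg 3 k l three_ne_zero h, red3, map_expand, expand_three_eq_pow]; rfl

lemma expand_uf (j k l : ℕ) (hj : j ≠ 0) [NeZero k] [NeZero l] (h : j * k = l) :
    expand j hj (uf k) = uf l := by
  rw [uf, red3, ← map_expand, expand_ef j k l hj h]; rfl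

lemma constantCoeff_uf (k : ℕ) [NeZero k] : constantCoeff (uf k) = 1 := by
  rw [uf, red3, ← coeff_zero_eq_constantCoeff_apply, coeff_map, coeff_zero_eq_constantCoeff_apply,
    constantCoeff_ef, map_one]

lemma uf_cube_relation : uf 1 ^ 8 * uf 2 ^ 8 = uf 1 ^ 24 + X * uf 2 ^ 24 := by
  have h := congrArg red3 phi_dissection
  simp only [map_mul, map_pow, map_sub, map_ofNat, red3_X, red3_ef, red3_eg] at h
  have h1 := uf_mul_ug 1
  have h2 := uf_mul_ug 2
  rw [uf_three_mul 3 9 rfl, ug_three_mul 3 9 rfl, uf_three_mul 6 18 rfl, ug_three_mul 6 18 rfl,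
    uf_three_mul 1 3 rfl, ug_three_mul 1 3 rfl, uf_three_mul 2 6 rfl, ug_three_mul 2 6 rfl] at h
  have h' : uf 1 ^ 8 * uf 2 ^ 8 = uf 1 ^ 24 - 2 * (X * uf 2 ^ 24) := by grind
  linear_combination h' - X * uf 2 ^ 24 * three_eq_zero

lemma uf_cube_relation' : uf 2 ^ 8 * uf 4 ^ 8 = uf 2 ^ 24 + X ^ 2 * uf 4 ^ 24 := by
  have h := congrArg (expand 2 two_ne_zero) uf_cube_relation
  simpa only [map_mul, map_pow, map_add, expand_X, expand_uf 2 1 2 _ rfl, expand_uf 2 2 4 _ rfl]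
    using h

lemma uf_ne_zero (k : ℕ) [NeZero k] : uf k ≠ 0 := fun h ↦ by
  have := uf_mul_ug k
  rw [h, zero_mul] at this
  exact zero_ne_one this

/-- With a, b, c the eighth powers of f₁, f₂, f₄, the relations ab = a³ + Xb³ and bc = b³ + X²c³
combine to eliminate abc; what remains has the factor a - Xc, which is nonzero by its constant term.
-/
lemma uf_quadratic_relation : (uf 1 ^ 8) ^ 2 * uf 4 ^ 8 - (uf 2 ^ 8) ^ 3
    + X * uf 1 ^ 8 * (uf 4 ^ 8) ^ 2 = 0 := by
  have h1 := uf_cube_relation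
  have h2 := uf_cube_relation'
  have hne : uf 1 ^ 8 - X * uf 4 ^ 8 ≠ 0 := fun h ↦ by
    have h0 := congrArg (constantCoeff (R := ZMod 3)) h
    simp [constantCoeff_uf] at h0
  refine (mul_eq_zero.mp ?_).resolve_left hne
  linear_combination (-uf 4 ^ 8) * h1 + uf 1 ^ 8 * h2

/-- Modulo 3 we have `f₁⁸ = f₂⁴ + q f₄⁸`. -/
lemma uf_fourth_power_relation : uf 1 ^ 8 = uf 2 ^ 4 + X * uf 4 ^ 8 := by
  have h1 := uf_quadratic_relation
  have h2 := uf_cube_relation'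
  have h3 := three_eq_zero
  have hsq : (uf 1 ^ 8 - X * uf 4 ^ 8) ^ 2 = (uf 2 ^ 4) ^ 2 := by
    refine mul_left_cancel₀ (pow_ne_zero 8 (uf_ne_zero 4)) ?_
    linear_combination h1 - h2 - (X * uf 1 ^ 8 * uf 4 ^ 16) * h3
  rcases sq_eq_sq_iff_eq_or_eq_neg.mp hsq with h | h
  · linear_combination h
  -- The other square root would force `1 = -1` modulo 3 in the constant term.
  · have h0 := congrArg (constantCoeff (R := ZMod 3)) h
    simp [constantCoeff_uf] at h0
    exact absurd h0 (by decide)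

lemma sect_pow_three_mul {i : ℕ} (hi : i < 3) (g h : (ZMod 3)⟦X⟧) :
    sect i (g ^ 3 * h) = g * sect i h := by
  rw [← expand_three_eq_pow, sect_expand_mul hi]

lemma sect_of_eq_pow {g a b c : (ZMod 3)⟦X⟧} (h : g = a ^ 3 + X * b ^ 3 + X ^ 2 * c ^ 3) :
    sect 0 g = a ∧ sect 1 g = b ∧ sect 2 g = c := by
  refine sect_of_eq ?_
  simpa only [expand_three_eq_pow] using h

lemma add_pow_three (a b : (ZMod 3)⟦X⟧) : (a + b) ^ 3 = a ^ 3 + b ^ 3 := by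
  linear_combination (a ^ 2 * b + a * b ^ 2) * three_eq_zero

lemma two_pow_three : (2 : (ZMod 3)⟦X⟧) ^ 3 = 2 := by
  linear_combination 2 * three_eq_zero

/-- Multiply and divide by powers of f₁⁸f₂⁸ and f₂⁸f₄⁸ so that what is left outside is a cube. By
the cube relations those powers expand into powers of `X` times cubes, and cubes are series in q³
modulo 3, so the sections can be read off. The next two lemmas use the same device. -/
lemma sect_uf_one_div_uf_four :
    sect 1 (uf 1 * ug 4) = -uf 2 ^ 12 * ug 1 ^ 5 * ug 4 ^ 3 ∧
    sect 2 (uf 1 * ug 4) = (uf 1 ^ 16 * uf 4 ^ 8 + uf 2 ^ 24) *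
      (ug 1 ^ 5 * ug 2 ^ 8 * ug 4 ^ 3) := by
  have h1 := uf_mul_ug 1
  have h2 := uf_mul_ug 2
  have h4 := uf_mul_ug 4
  have key : uf 1 * ug 4 = (uf 1 ^ 24 + X * uf 2 ^ 24) ^ 2 * (uf 2 ^ 24 + X ^ 2 * uf 4 ^ 24) *
      (ug 1 ^ 15 * ug 2 ^ 24 * ug 4 ^ 9) := by
    rw [← uf_cube_relation, ← uf_cube_relation']
    grind
  have key2 := sect_of_eq_pow (g := uf 1 * ug 4)
    (a := (uf 1 ^ 16 * uf 2 ^ 8 + 2 * X * uf 1 ^ 8 * uf 2 ^ 8 * uf 4 ^ 8) *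
      (ug 1 ^ 5 * ug 2 ^ 8 * ug 4 ^ 3))
    (b := (2 * uf 1 ^ 8 * uf 2 ^ 16 + X * uf 2 ^ 16 * uf 4 ^ 8) * (ug 1 ^ 5 * ug 2 ^ 8 * ug 4 ^ 3))
    (c := (uf 1 ^ 16 * uf 4 ^ 8 + uf 2 ^ 24) * (ug 1 ^ 5 * ug 2 ^ 8 * ug 4 ^ 3)) (by
      simp only [mul_pow, add_pow_three, two_pow_three]
      rw [key]
      ring)
  refine ⟨?_, key2.2.2⟩
  rw [key2.2.1]
  have hb : 2 * uf 1 ^ 8 * uf 2 ^ 16 + X * uf 2 ^ 16 * uf 4 ^ 8 = -uf 2 ^ 20 := by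
    linear_combination (-uf 2 ^ 16) * uf_fourth_power_relation +
      uf 1 ^ 8 * uf 2 ^ 16 * three_eq_zero
  rw [hb]
  have h28 : uf 2 ^ 8 * ug 2 ^ 8 = 1 := by rw [← mul_pow, h2, one_pow]
  linear_combination (-uf 2 ^ 12 * ug 1 ^ 5 * ug 4 ^ 3) * h28

lemma sect_zero_uf_four_div_uf_one :
    sect 0 (uf 4 * ug 1) = uf 2 ^ 12 * ug 4 ^ 5 * ug 1 ^ 3 := by
  have h1 := uf_mul_ug 1
  have h2 := uf_mul_ug 2
  have h4 := uf_mul_ug 4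
  have key : uf 4 * ug 1 = (uf 1 ^ 24 + X * uf 2 ^ 24) * (uf 2 ^ 24 + X ^ 2 * uf 4 ^ 24) ^ 2 *
      (ug 1 ^ 9 * ug 2 ^ 24 * ug 4 ^ 15) := by
    rw [← uf_cube_relation, ← uf_cube_relation']
    grind
  have key2 := sect_of_eq_pow (g := uf 4 * ug 1)
    (a := (uf 1 ^ 8 * uf 2 ^ 16 + 2 * X * uf 2 ^ 16 * uf 4 ^ 8) *
      (ug 1 ^ 3 * ug 2 ^ 8 * ug 4 ^ 5))
    (b := (uf 2 ^ 24 + X * uf 1 ^ 8 * uf 4 ^ 16) * (ug 1 ^ 3 * ug 2 ^ 8 * ug 4 ^ 5))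
    (c := (2 * uf 1 ^ 8 * uf 2 ^ 8 * uf 4 ^ 8 + X * uf 2 ^ 8 * uf 4 ^ 16) *
      (ug 1 ^ 3 * ug 2 ^ 8 * ug 4 ^ 5)) (by
      simp only [mul_pow, add_pow_three, two_pow_three]
      rw [key]
      ring)
  rw [key2.1]
  have hb : uf 1 ^ 8 * uf 2 ^ 16 + 2 * X * uf 2 ^ 16 * uf 4 ^ 8 = uf 2 ^ 20 := by
    linear_combination uf 2 ^ 16 * uf_fourth_power_relation +
      X * uf 4 ^ 8 * uf 2 ^ 16 * three_eq_zero
  rw [hb]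
  have h28 : uf 2 ^ 8 * ug 2 ^ 8 = 1 := by rw [← mul_pow, h2, one_pow]
  linear_combination (uf 2 ^ 12 * ug 4 ^ 5 * ug 1 ^ 3) * h28

lemma sect_one_uf_product :
    sect 1 (uf 1 * uf 2 ^ 2 * uf 4) = (2 * uf 1 ^ 8 * uf 2 ^ 24 + 2 * X * uf 2 ^ 24 * uf 4 ^ 8 +
      X * uf 1 ^ 16 * uf 4 ^ 16) * (ug 1 ^ 5 * ug 2 ^ 10 * ug 4 ^ 5) := by
  have h1 := uf_mul_ug 1
  have h2 := uf_mul_ug 2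
  have h4 := uf_mul_ug 4
  have key : uf 1 * uf 2 ^ 2 * uf 4 = (uf 1 ^ 24 + X * uf 2 ^ 24) ^ 2 *
      (uf 2 ^ 24 + X ^ 2 * uf 4 ^ 24) ^ 2 * (ug 1 ^ 15 * ug 2 ^ 30 * ug 4 ^ 15) := by
    rw [← uf_cube_relation, ← uf_cube_relation']
    grind
  refine (sect_of_eq_pow (g := uf 1 * uf 2 ^ 2 * uf 4)
    (a := (uf 1 ^ 16 * uf 2 ^ 16 + 4 * X * uf 1 ^ 8 * uf 2 ^ 16 * uf 4 ^ 8 +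
      X ^ 2 * uf 2 ^ 16 * uf 4 ^ 16) * (ug 1 ^ 5 * ug 2 ^ 10 * ug 4 ^ 5))
    (c := (2 * uf 1 ^ 16 * uf 2 ^ 8 * uf 4 ^ 8 + uf 2 ^ 32 + 2 * X * uf 1 ^ 8 * uf 2 ^ 8 *
      uf 4 ^ 16) * (ug 1 ^ 5 * ug 2 ^ 10 * ug 4 ^ 5)) ?_).2.1
  have e4 : (4 : (ZMod 3)⟦X⟧) ^ 3 = 4 := by linear_combination 20 * three_eq_zero
  simp only [mul_pow, add_pow_three, two_pow_three, e4]
  rw [key]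
  ring

end ModThree

/-! ### The first section modulo 9 -/

section ModNine

lemma nine_dvd_three_mul {a b : ℤ⟦X⟧} (h : red3 a = red3 b) : 9 ∣ 3 * a - 3 * b := by
  rw [← mul_sub, show (9 : ℤ⟦X⟧) = 3 * 3 by norm_num]
  exact mul_dvd_mul_left 3 ((three_dvd_sub_iff a b).mpr h)

lemma nine_dvd_cube_sub_cube {a b : ℤ⟦X⟧} (h : red3 a = red3 b) : 9 ∣ a ^ 3 - b ^ 3 := by
  obtain ⟨z, hz⟩ := (three_dvd_sub_iff a b).mpr h
  exact ⟨3 * z ^ 3 + a * b * z, by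
    linear_combination ((a - b) ^ 2 + 3 * z * (a - b) + 9 * z ^ 2 + 3 * a * b) * hz⟩

lemma nine_dvd_eg_pow (k l : ℕ) [NeZero k] [NeZero l] (h : 3 * k = l) :
    9 ∣ eg k ^ 9 - eg l ^ 3 := by
  rw [show eg k ^ 9 = (eg k ^ 3) ^ 3 by ring]
  refine nine_dvd_cube_sub_cube ?_
  rw [map_pow, red3_eg, red3_eg, ug_three_mul k l h]

lemma expand_three_tq : expand 3 three_ne_zero tq = ef 6 * ef 9 ^ 3 * eg 3 * eg 18 ^ 3 := by
  simp only [tq, map_mul, map_pow, expand_ef 3 2 6 _ rfl, expand_ef 3 3 9 _ rfl,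
    expand_eg 3 1 3 _ rfl, expand_eg 3 6 18 _ rfl]

/-- The quotient `tq` at `q²`. -/
noncomputable def sq : ℤ⟦X⟧ := ef 4 * ef 6 ^ 3 * eg 2 * eg 12 ^ 3

lemma expand_two_tq : expand 2 two_ne_zero tq = sq := by
  simp only [tq, sq, map_mul, map_pow, expand_ef 2 2 4 _ rfl, expand_ef 2 3 6 _ rfl,
    expand_eg 2 1 2 _ rfl, expand_eg 2 6 12 _ rfl]

lemma sq_cube_add_X_sq : sq ^ 3 + X ^ 2 = ef 4 ^ 8 * ef 6 ^ 4 * eg 2 ^ 4 * eg 12 ^ 8 := by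
  have h := congrArg (expand 2 two_ne_zero) tq_cube_add_X
  simpa only [map_add, map_mul, map_pow, expand_two_tq, expand_X, expand_ef 2 2 4 _ rfl,
    expand_ef 2 3 6 _ rfl, expand_eg 2 1 2 _ rfl, expand_eg 2 6 12 _ rfl] using h

/-- Both φ(-q) here and ψ(q) in `psi_factor` become linear in one and the same series in q³, so
products of them are polynomials in it. -/
lemma phi_factor : ef 1 ^ 2 * eg 2 =
    expand 3 three_ne_zero (ef 1 * ef 6 ^ 2 * eg 2 * eg 3) *
      (expand 3 three_ne_zero tq - 2 * X) := by
  have h := phi_dissection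
  rw [expand_three_tq]
  simp only [map_mul, map_pow, expand_ef 3 1 3 _ rfl, expand_ef 3 6 18 _ rfl,
    expand_eg 3 2 6 _ rfl, expand_eg 3 3 9 _ rfl]
  have h3 := ef_mul_eg 3
  have h6 := ef_mul_eg 6
  have h9 := ef_mul_eg 9
  have h18 := ef_mul_eg 18
  grind

lemma psi_factor : ef 2 ^ 2 * eg 1 = expand 3 three_ne_zero (ef 6 ^ 2 * eg 3) *
    (expand 3 three_ne_zero tq + X) := by
  have h := psi_dissection
  rw [expand_three_tq]
  simp only [map_mul, map_pow, expand_ef 3 6 18 _ rfl, expand_eg 3 3 9 _ rfl]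
  have h9 := ef_mul_eg 9
  have h18 := ef_mul_eg 18
  grind

lemma expand_two_expand_three {R : Type*} [CommRing R] (g : R⟦X⟧) :
    expand 2 two_ne_zero (expand 3 three_ne_zero g) =
      expand 3 three_ne_zero (expand 2 two_ne_zero g) := by
  rw [← expand_mul, ← expand_mul]

lemma phi_factor_two : ef 2 ^ 2 * eg 4 =
    expand 3 three_ne_zero (ef 2 * ef 12 ^ 2 * eg 4 * eg 6) *
      (expand 3 three_ne_zero sq - 2 * X ^ 2) := by
  have h := congrArg (expand 2 two_ne_zero) phi_factor
  simpa only [map_mul, map_sub, map_ofNat, map_pow, expand_two_expand_three, expand_two_tq,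
    expand_X, expand_ef 2 1 2 _ rfl, expand_ef 2 6 12 _ rfl, expand_eg 2 2 4 _ rfl,
    expand_eg 2 3 6 _ rfl] using h

lemma psi_factor_two : ef 4 ^ 2 * eg 2 = expand 3 three_ne_zero (ef 12 ^ 2 * eg 6) *
    (expand 3 three_ne_zero sq + X ^ 2) := by
  have h := congrArg (expand 2 two_ne_zero) psi_factor
  simpa only [map_mul, map_add, map_pow, expand_two_expand_three, expand_two_tq, expand_X,
    expand_ef 2 2 4 _ rfl, expand_ef 2 6 12 _ rfl, expand_eg 2 1 2 _ rfl, expand_eg 2 3 6 _ rfl]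
    using h

/-- The exact value of the first section of `f₁² / (f₂² f₄)`, with denominators cleared. -/
lemma sect_one_generating_exact :
    (ef 2 * ef 12 ^ 2 * eg 4 * eg 6) * (ef 12 ^ 2 * eg 6) * ((sq ^ 3 - 8 * X ^ 2) *
      (sq ^ 3 + X ^ 2)) * sect 1 (ef 1 ^ 2 * eg 2 ^ 2 * eg 4) =
    (ef 1 * ef 6 ^ 2 * eg 2 * eg 3) * (3 * X * sq ^ 2 * tq - 2 * sq ^ 4 + 4 * X ^ 2 * sq) := by
  have h2 := ef_mul_eg 2
  have h4 := ef_mul_eg 4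
  -- The generating function is φ(-q)/(φ(-q²)ψ(q²)).
  have e1 : ef 1 ^ 2 * eg 2 ^ 2 * eg 4 * ((ef 2 ^ 2 * eg 4) * (ef 4 ^ 2 * eg 2)) =
      ef 1 ^ 2 * eg 2 := by
    grind
  rw [phi_factor_two, psi_factor_two, phi_factor] at e1
  rw [← sect_expand_mul (by norm_num)]
  refine (sect_of_eq (a := (ef 1 * ef 6 ^ 2 * eg 2 * eg 3) *
      (tq * sq ^ 4 - 2 * X ^ 2 * sq * tq - 2 * X * sq ^ 3 - 8 * X ^ 3))
    (c := (ef 1 * ef 6 ^ 2 * eg 2 * eg 3) * (tq * sq ^ 3 + 4 * X ^ 2 * tq - 6 * X * sq ^ 2)) ?_).2.1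
  simp only [map_mul, map_add, map_sub, map_pow, map_ofNat, expand_X] at e1 ⊢
  -- The two quadratic cofactors complete `S - 2 X ^ 2` and `S + X ^ 2` to `S ^ 3 - 8 X ^ 6` and `S
  -- ^ 3 + X ^ 6`, which are series in q³.
  linear_combination ((expand 3 three_ne_zero sq ^ 2 + 2 * X ^ 2 * expand 3 three_ne_zero sq +
    4 * X ^ 4) * (expand 3 three_ne_zero sq ^ 2 - X ^ 2 * expand 3 three_ne_zero sq + X ^ 4)) * e1

section Monomials
variable {R : Type*} [CommRing R]

lemma kappa_mul_inv {f2 g2 f4 g4 f6 g6 f12 g12 : R} (h2 : f2 * g2 = 1) (h4 : f4 * g4 = 1)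
    (h6 : f6 * g6 = 1) (h12 : f12 * g12 = 1) : (f4 ^ 8 * f6 ^ 4 * g2 ^ 4 * g12 ^ 8) *
      (g4 ^ 8 * g6 ^ 4 * f2 ^ 4 * f12 ^ 8) = 1 := by
  rw [show (f4 ^ 8 * f6 ^ 4 * g2 ^ 4 * g12 ^ 8) * (g4 ^ 8 * g6 ^ 4 * f2 ^ 4 * f12 ^ 8) =
    (f4 * g4) ^ 8 * (f6 * g6) ^ 4 * (f2 * g2) ^ 4 * (f12 * g12) ^ 8 by ring, h2, h4, h6, h12]
  simp

lemma prefactor_mul_inv {f2 g2 f4 g4 f6 g6 f12 g12 : R} (h2 : f2 * g2 = 1) (h4 : f4 * g4 = 1)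
    (h6 : f6 * g6 = 1) (h12 : f12 * g12 = 1) : (g2 * g12 ^ 4 * f4 * f6 ^ 2) *
      ((f2 * f12 ^ 2 * g4 * g6) * (f12 ^ 2 * g6)) = 1 := by
  rw [show (g2 * g12 ^ 4 * f4 * f6 ^ 2) * ((f2 * f12 ^ 2 * g4 * g6) * (f12 ^ 2 * g6)) =
    (f2 * g2) * (f4 * g4) * (f6 * g6) ^ 2 * (f12 * g12) ^ 4 by ring, h2, h4, h6, h12]
  simp

lemma main_monomial {f1 f2 g2 g3 f4 g4 f6 g6 f12 g12 : R} (h2 : f2 * g2 = 1) (h4 : f4 * g4 = 1)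
    (h6 : f6 * g6 = 1) (h12 : f12 * g12 = 1) : (g2 * g12 ^ 4 * f4 * f6 ^ 2) *
      (g4 ^ 8 * g6 ^ 4 * f2 ^ 4 * f12 ^ 8) * (f1 * f6 ^ 2 * g2 * g3) *
      (f4 * f6 ^ 3 * g2 * g12 ^ 3) = f1 * f2 * g4 ^ 6 * (f6 ^ 3 * f12 * g3) := by
  rw [show (g2 * g12 ^ 4 * f4 * f6 ^ 2) * (g4 ^ 8 * g6 ^ 4 * f2 ^ 4 * f12 ^ 8) *
      (f1 * f6 ^ 2 * g2 * g3) * (f4 * f6 ^ 3 * g2 * g12 ^ 3) =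
    (f2 * g2) ^ 3 * (f4 * g4) ^ 2 * (f6 * g6) ^ 4 * (f12 * g12) ^ 7 *
      (f1 * f2 * g4 ^ 6 * (f6 ^ 3 * f12 * g3)) by ring, h2, h4, h6, h12]
  simp

lemma error_monomial {x f1 g1 f2 g2 f4 g4 : R} (h3 : (3 : R) = 0) (h1 : f1 * g1 = 1)
    (h2 : f2 * g2 = 1) (h4 : f4 * g4 = 1) (hq : f1 ^ 8 = f2 ^ 4 + x * f4 ^ 8) :
    (g2 * (g4 ^ 3) ^ 4 * f4 * (f2 ^ 3) ^ 2) *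
      (g4 ^ 8 * (g2 ^ 3) ^ 4 * f2 ^ 4 * (f4 ^ 3) ^ 8) ^ 2 * (f1 * (f2 ^ 3) ^ 2 * g2 * g1 ^ 3) *
      (f4 * (f2 ^ 3) ^ 3 * g2 * (g4 ^ 3) ^ 3) *
      ((f4 * (f2 ^ 3) ^ 3 * g2 * (g4 ^ 3) ^ 3) * (f2 * (f1 ^ 3) ^ 3 * g1 * (g2 ^ 3) ^ 3) + 2 * x) =
    f1 * g4 * ((f2 ^ 3) ^ 2 * (f4 ^ 3) ^ 2 * g1 ^ 3) := by
  have e : (f4 * (f2 ^ 3) ^ 3 * g2 * (g4 ^ 3) ^ 3) * (f2 * (f1 ^ 3) ^ 3 * g1 * (g2 ^ 3) ^ 3) +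
      2 * x = f2 ^ 4 * g4 ^ 8 := by
    rw [show (f4 * (f2 ^ 3) ^ 3 * g2 * (g4 ^ 3) ^ 3) * (f2 * (f1 ^ 3) ^ 3 * g1 * (g2 ^ 3) ^ 3) =
      (f1 * g1) * (f2 * g2) ^ 10 * (f4 * g4) * (f1 ^ 8 * g4 ^ 8) by ring, h1, h2, h4]
    have h8 : f4 ^ 8 * g4 ^ 8 = 1 := by rw [← mul_pow, h4, one_pow]
    linear_combination g4 ^ 8 * hq + x * h8 + x * h3
  rw [e]
  rw [show (g2 * (g4 ^ 3) ^ 4 * f4 * (f2 ^ 3) ^ 2) *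
      (g4 ^ 8 * (g2 ^ 3) ^ 4 * f2 ^ 4 * (f4 ^ 3) ^ 8) ^ 2 * (f1 * (f2 ^ 3) ^ 2 * g2 * g1 ^ 3) *
      (f4 * (f2 ^ 3) ^ 3 * g2 * (g4 ^ 3) ^ 3) * (f2 ^ 4 * g4 ^ 8) =
    (f2 * g2) ^ 27 * (f4 * g4) ^ 44 * (f1 * g4 * ((f2 ^ 3) ^ 2 * (f4 ^ 3) ^ 2 * g1 ^ 3)) by ring,
    h2, h4]
  simp

end Monomials

/-- The first section of `f₁² / (f₂² f₄)` modulo 9. -/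
lemma sect_one_generating : 9 ∣ sect 1 (ef 1 ^ 2 * eg 2 ^ 2 * eg 4) -
    (-2 * (ef 1 * ef 2 * ef 4 ^ 3 * (ef 6 ^ 3 * eg 3 * eg 12 ^ 2)) +
      3 * (X * ef 1 * eg 4 * (ef 6 ^ 2 * ef 12 ^ 2 * eg 3))) := by
  have h2 := ef_mul_eg 2
  have h4 := ef_mul_eg 4
  have h6 := ef_mul_eg 6
  have h12 := ef_mul_eg 12
  have hex := sect_one_generating_exact
  have hk := sq_cube_add_X_sq
  have hkl := kappa_mul_inv h2 h4 h6 h12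
  have hJ1 := prefactor_mul_inv h2 h4 h6 h12
  have hm := main_monomial (f1 := ef 1) (g3 := eg 3) h2 h4 h6 h12
  rw [show ef 4 * ef 6 ^ 3 * eg 2 * eg 12 ^ 3 = sq from rfl] at hm
  set U := sect 1 (ef 1 ^ 2 * eg 2 ^ 2 * eg 4)
  set J := eg 2 * eg 12 ^ 4 * ef 4 * ef 6 ^ 2 with hJ
  set k := ef 4 ^ 8 * ef 6 ^ 4 * eg 2 ^ 4 * eg 12 ^ 8 with hkdef
  set l := eg 4 ^ 8 * eg 6 ^ 4 * ef 2 ^ 4 * ef 12 ^ 8 with hl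
  set om := ef 1 * ef 6 ^ 2 * eg 2 * eg 3 with hom
  set P := ef 2 * ef 12 ^ 2 * eg 4 * eg 6 * (ef 12 ^ 2 * eg 6) with hP
  -- Here `k = sq ^ 3 + X ^ 2` has inverse `l`, and `sq ^ 3 - 8 X ^ 2 = k - 9 X ^ 2`; the
  -- denominator is thus `k ^ 2` up to a multiple of 9.
  have hU : U = J * l ^ 2 * om * (3 * X * sq ^ 2 * tq - 2 * sq ^ 4 + 4 * X ^ 2 * sq) +
      9 * (X ^ 2 * l * U) := by
    linear_combination J * l ^ 2 * hex - l ^ 2 * (sq ^ 3 - 8 * X ^ 2) * (sq ^ 3 + X ^ 2) * U * hJ1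
      - l ^ 2 * U * (sq ^ 3 + X ^ 2 + k - 9 * X ^ 2) * hk - (k * l + 1) * U * hkl
      + 9 * X ^ 2 * l * U * hkl
  have hmain : J * l ^ 2 * om * (3 * X * sq ^ 2 * tq - 2 * sq ^ 4 + 4 * X ^ 2 * sq) =
      -2 * (J * l * om * sq) + 3 * (X * (J * l ^ 2 * om * sq * (sq * tq + 2 * X))) := by
    linear_combination (-2 * J * l ^ 2 * om * sq) * hk - 2 * J * l * om * sq * hkl
  -- Prepares `eg 4 ^ 9 ≡ eg 12 ^ 3` modulo 9, leaving f₄³, whose dissection is explicit.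
  have h1' : eg 4 ^ 6 = eg 4 ^ 9 * ef 4 ^ 3 := by
    rw [show eg 4 ^ 9 * ef 4 ^ 3 = (ef 4 * eg 4) ^ 3 * eg 4 ^ 6 by ring, h4]
    simp
  have h2' : red3 (X * (J * l ^ 2 * om * sq * (sq * tq + 2 * X))) =
      red3 (X * ef 1 * eg 4 * (ef 6 ^ 2 * ef 12 ^ 2 * eg 3)) := by
    simp only [hJ, hl, hom, sq, tq, map_mul, map_add, map_pow, map_ofNat, red3_X, red3_ef, red3_eg,
      uf_three_mul 2 6 rfl, ug_three_mul 2 6 rfl, uf_three_mul 4 12 rfl, ug_three_mul 4 12 rfl,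
      uf_three_mul 1 3 rfl, ug_three_mul 1 3 rfl]
    have := error_monomial three_eq_zero (uf_mul_ug 1) (uf_mul_ug 2) (uf_mul_ug 4)
      uf_fourth_power_relation
    linear_combination X * this
  obtain ⟨z1, d1⟩ := nine_dvd_eg_pow 4 12 rfl
  obtain ⟨z2, d2⟩ := nine_dvd_three_mul h2'
  refine ⟨X ^ 2 * l * U + z2 - 2 * ef 1 * ef 2 * ef 4 ^ 3 * ef 6 ^ 3 * ef 12 * eg 3 * z1, ?_⟩
  linear_combination hU + hmain - 2 * hm - 2 * ef 1 * ef 2 * (ef 6 ^ 3 * ef 12 * eg 3) * h1' + d2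
    - 2 * ef 1 * ef 2 * ef 4 ^ 3 * ef 6 ^ 3 * ef 12 * eg 3 * d1
    - 2 * ef 1 * ef 2 * ef 4 ^ 3 * ef 6 ^ 3 * eg 3 * eg 12 ^ 2 * h12

end ModNine

/-! ### Dissections of a(q) and of the cube of f₁ -/

section Cubes

lemma nine_dvd_sect {i : ℕ} {g : ℤ⟦X⟧} (h : 9 ∣ g) : 9 ∣ sect i g := by
  exact_mod_cast natCast_dvd_sect (n := 9) (i := i) (by exact_mod_cast h)

/-- Ramanujan's cubic theta function `a(q)`, written as an eta quotient combination. -/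
noncomputable def aq : ℤ⟦X⟧ := ef 1 * ef 6 ^ 6 * eg 2 ^ 2 * eg 3 ^ 3 * (tq ^ 3 + 4 * X)

lemma expand_three_prefactor : expand 3 three_ne_zero (ef 1 * ef 6 ^ 6 * eg 2 ^ 2 * eg 3 ^ 3) =
    ef 3 * ef 18 ^ 6 * eg 6 ^ 2 * eg 9 ^ 3 := by
  simp only [map_mul, map_pow, expand_ef 3 1 3 _ rfl, expand_ef 3 6 18 _ rfl,
    expand_eg 3 2 6 _ rfl, expand_eg 3 3 9 _ rfl]

lemma expand_three_tq_sq_mul : (ef 3 * ef 18 ^ 6 * eg 6 ^ 2 * eg 9 ^ 3) *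
    expand 3 three_ne_zero tq ^ 2 = ef 9 ^ 3 * eg 3 := by
  have h3 := ef_mul_eg 3
  have h6 := ef_mul_eg 6
  have h9 := ef_mul_eg 9
  have h18 := ef_mul_eg 18
  rw [expand_three_tq, show (ef 3 * ef 18 ^ 6 * eg 6 ^ 2 * eg 9 ^ 3) *
    (ef 6 * ef 9 ^ 3 * eg 3 * eg 18 ^ 3) ^ 2 = (ef 3 * eg 3) * (ef 6 * eg 6) ^ 2 *
    (ef 9 * eg 9) ^ 3 * (ef 18 * eg 18) ^ 6 * (ef 9 ^ 3 * eg 3) by ring, h3, h6, h9, h18]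
  simp

/-- The left side is a series in q³ divided by ψ(q), and `1 / (T + X)` is rationalised by `T ^ 2 - X
* T + X ^ 2`. -/
lemma prefactor_dissection : ef 1 * ef 6 ^ 6 * eg 2 ^ 2 * eg 3 ^ 3 =
    (ef 3 * ef 18 ^ 6 * eg 6 ^ 2 * eg 9 ^ 3) * (expand 3 three_ne_zero tq ^ 2 -
      X * expand 3 three_ne_zero tq + X ^ 2) := by
  have hp := psi_factor
  have hk := congrArg (expand 3 three_ne_zero) tq_cube_add_X
  simp only [map_mul, map_pow, map_add, expand_X, expand_ef 3 6 18 _ rfl, expand_ef 3 3 9 _ rfl,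
    expand_ef 3 2 6 _ rfl, expand_eg 3 3 9 _ rfl, expand_eg 3 6 18 _ rfl,
    expand_eg 3 1 3 _ rfl] at hp hk
  have h1 := ef_mul_eg 1
  have h2 := ef_mul_eg 2
  have h3 := ef_mul_eg 3
  have h6 := ef_mul_eg 6
  have h9 := ef_mul_eg 9
  have h18 := ef_mul_eg 18
  set T := expand 3 three_ne_zero tq
  set v := ef 1 * ef 6 ^ 6 * eg 2 ^ 2 * eg 3 ^ 3 with hv
  have e1 : v * (ef 2 ^ 2 * eg 1) = ef 6 ^ 6 * eg 3 ^ 3 := by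
    rw [hv, show ef 1 * ef 6 ^ 6 * eg 2 ^ 2 * eg 3 ^ 3 * (ef 2 ^ 2 * eg 1) =
      (ef 1 * eg 1) * (ef 2 * eg 2) ^ 2 * (ef 6 ^ 6 * eg 3 ^ 3) by ring, h1, h2]
    simp
  have e2 : (ef 18 ^ 2 * eg 9) * (ef 6 ^ 8 * ef 9 ^ 4 * eg 3 ^ 4 * eg 18 ^ 8) *
      (eg 6 ^ 8 * eg 9 ^ 3 * ef 3 ^ 4 * ef 18 ^ 6) = 1 := by
    rw [show (ef 18 ^ 2 * eg 9) * (ef 6 ^ 8 * ef 9 ^ 4 * eg 3 ^ 4 * eg 18 ^ 8) *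
      (eg 6 ^ 8 * eg 9 ^ 3 * ef 3 ^ 4 * ef 18 ^ 6) = (ef 3 * eg 3) ^ 4 * (ef 6 * eg 6) ^ 8 *
      (ef 9 * eg 9) ^ 4 * (ef 18 * eg 18) ^ 8 by ring, h3, h6, h9, h18]
    simp
  have e3 : ef 6 ^ 6 * eg 3 ^ 3 * (eg 6 ^ 8 * eg 9 ^ 3 * ef 3 ^ 4 * ef 18 ^ 6) =
      ef 3 * ef 18 ^ 6 * eg 6 ^ 2 * eg 9 ^ 3 := by
    rw [show ef 6 ^ 6 * eg 3 ^ 3 * (eg 6 ^ 8 * eg 9 ^ 3 * ef 3 ^ 4 * ef 18 ^ 6) =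
      (ef 6 * eg 6) ^ 6 * (ef 3 * eg 3) ^ 3 * (ef 3 * ef 18 ^ 6 * eg 6 ^ 2 * eg 9 ^ 3) by ring,
      h3, h6]
    simp
  rw [← e3, ← e1, hp]
  linear_combination (-v) * e2 + (-v * (ef 18 ^ 2 * eg 9) *
    (eg 6 ^ 8 * eg 9 ^ 3 * ef 3 ^ 4 * ef 18 ^ 6)) * hk

/-- Split `tq ^ 3 + 4 X` as `(tq ^ 3 + X) + 3 X`. The first part gives ψ(q)³ times a series in q³,
the second is `prefactor_dissection`, and `(T + X) ^ 3 + 3 X (T ^ 2 - X T + X ^ 2) = T ^ 3 + 6 X T ^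
2 + 4 X ^ 3`. -/
lemma aq_dissection : aq = expand 3 three_ne_zero aq + 6 * X * (ef 9 ^ 3 * eg 3) := by
  have hp := psi_factor
  have hk := tq_cube_add_X
  have hT := expand_three_tq_sq_mul
  have hB := prefactor_dissection
  have hE : expand 3 three_ne_zero aq = (ef 3 * ef 18 ^ 6 * eg 6 ^ 2 * eg 9 ^ 3) *
      (expand 3 three_ne_zero tq ^ 3 + 4 * X ^ 3) := by
    rw [aq, map_mul, expand_three_prefactor, map_add, map_mul, map_pow, map_ofNat, expand_X]
  have h1 := ef_mul_eg 1
  have h2 := ef_mul_eg 2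
  have h3 := ef_mul_eg 3
  have h6 := ef_mul_eg 6
  simp only [map_mul, map_pow, expand_ef 3 6 18 _ rfl, expand_eg 3 3 9 _ rfl] at hp
  have e1 : (ef 1 * ef 6 ^ 6 * eg 2 ^ 2 * eg 3 ^ 3) * (ef 2 ^ 8 * ef 3 ^ 4 * eg 1 ^ 4 * eg 6 ^ 8) =
      (ef 2 ^ 2 * eg 1) ^ 3 * (ef 3 * eg 6 ^ 2) := by
    rw [show (ef 1 * ef 6 ^ 6 * eg 2 ^ 2 * eg 3 ^ 3) *
      (ef 2 ^ 8 * ef 3 ^ 4 * eg 1 ^ 4 * eg 6 ^ 8) = (ef 1 * eg 1) * (ef 2 * eg 2) ^ 2 *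
      (ef 3 * eg 3) ^ 3 * (ef 6 * eg 6) ^ 6 * ((ef 2 ^ 2 * eg 1) ^ 3 * (ef 3 * eg 6 ^ 2)) by ring,
      h1, h2, h3, h6]
    simp
  rw [hp] at e1
  rw [hE, ← hT, aq]
  set T := expand 3 three_ne_zero tq
  linear_combination (ef 1 * ef 6 ^ 6 * eg 2 ^ 2 * eg 3 ^ 3) * hk + e1 + 3 * X * hB

/-- f₁³ = φ(-q)²ψ(q), and `(T - 2 X) ^ 2 * (T + X) = T ^ 3 - 3 X T ^ 2 + 4 X ^ 3`. -/
lemma ef_one_cube_dissection :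
    ef 1 ^ 3 = ef 3 * expand 3 three_ne_zero aq - 3 * X * ef 9 ^ 3 := by
  have hp := psi_factor
  have hf := phi_factor
  have hT := expand_three_tq_sq_mul
  have hE : expand 3 three_ne_zero aq = (ef 3 * ef 18 ^ 6 * eg 6 ^ 2 * eg 9 ^ 3) *
      (expand 3 three_ne_zero tq ^ 3 + 4 * X ^ 3) := by
    rw [aq, map_mul, expand_three_prefactor, map_add, map_mul, map_pow, map_ofNat, expand_X]
  simp only [map_mul, map_pow, expand_ef 3 6 18 _ rfl, expand_eg 3 3 9 _ rfl,
    expand_ef 3 1 3 _ rfl, expand_eg 3 2 6 _ rfl] at hp hf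
  have h1 := ef_mul_eg 1
  have h2 := ef_mul_eg 2
  have h3 := ef_mul_eg 3
  have e1 : ef 1 ^ 3 = (ef 1 ^ 2 * eg 2) ^ 2 * (ef 2 ^ 2 * eg 1) := by
    rw [show (ef 1 ^ 2 * eg 2) ^ 2 * (ef 2 ^ 2 * eg 1) =
      (ef 1 * eg 1) * (ef 2 * eg 2) ^ 2 * ef 1 ^ 3 by ring, h1, h2]
    simp
  rw [e1, hp, hf, hE]
  set T := expand 3 three_ne_zero tq
  linear_combination (-3 * X * ef 3) * hT - 3 * X * ef 9 ^ 3 * h3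

/-- The function `aq` at `q⁴`. -/
noncomputable def aqFour : ℤ⟦X⟧ := expand 4 four_ne_zero aq

lemma expand_four_expand_three {R : Type*} [CommRing R] (g : R⟦X⟧) :
    expand 4 four_ne_zero (expand 3 three_ne_zero g) =
      expand 3 three_ne_zero (expand 4 four_ne_zero g) := by
  rw [← expand_mul, ← expand_mul]

lemma aqFour_dissection : aqFour = expand 3 three_ne_zero aqFour +
    X * expand 3 three_ne_zero (6 * X * (ef 12 ^ 3 * eg 4)) := by
  have h := congrArg (expand 4 four_ne_zero) aq_dissection
  simp only [map_mul, map_add, map_pow, map_ofNat, expand_four_expand_three, expand_X,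
    expand_ef 4 9 36 _ rfl, expand_eg 4 3 12 _ rfl] at h
  simp only [map_mul, map_pow, map_ofNat, expand_X, expand_ef 3 12 36 _ rfl,
    expand_eg 3 4 12 _ rfl]
  rw [← aqFour] at h
  linear_combination h

lemma ef_four_cube_dissection : ef 4 ^ 3 = expand 3 three_ne_zero (ef 4 * aqFour) -
    X * expand 3 three_ne_zero (3 * X * ef 12 ^ 3) := by
  have h := congrArg (expand 4 four_ne_zero) ef_one_cube_dissection
  simp only [map_mul, map_sub, map_pow, map_ofNat, expand_four_expand_three, expand_X,
    expand_ef 4 9 36 _ rfl, expand_ef 4 3 12 _ rfl, expand_ef 4 1 4 _ rfl] at h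
  simp only [map_mul, map_pow, map_ofNat, expand_X, expand_ef 3 12 36 _ rfl,
    expand_ef 3 4 12 _ rfl]
  rw [← aqFour] at h
  linear_combination h

end Cubes

/-! ### The second section modulo 9 -/

section SecondSection

/-- f₁f₂ = φ(-q)ψ(q) contributes `(T - 2 X)(T + X)`, to be multiplied by the two-term dissection of
f₄³. -/
lemma sect_two_product : sect 2 (ef 1 * ef 2 * ef 4 ^ 3) =
    (ef 1 * ef 6 ^ 4 * eg 2 * eg 3 ^ 2) * (-2 * (ef 4 * aqFour) + 3 * X * tq * ef 12 ^ 3) := by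
  have h1 := ef_mul_eg 1
  have h2 := ef_mul_eg 2
  have e1 : ef 1 * ef 2 = (ef 1 ^ 2 * eg 2) * (ef 2 ^ 2 * eg 1) := by
    rw [show (ef 1 ^ 2 * eg 2) * (ef 2 ^ 2 * eg 1) = (ef 1 * eg 1) * (ef 2 * eg 2) * (ef 1 * ef 2)
      by ring, h1, h2]
    simp
  refine (sect_of_eq (a := (ef 1 * ef 6 ^ 4 * eg 2 * eg 3 ^ 2) *
      (tq ^ 2 * (ef 4 * aqFour) + 6 * X ^ 2 * ef 12 ^ 3))
    (b := (ef 1 * ef 6 ^ 4 * eg 2 * eg 3 ^ 2) *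
      (-tq * (ef 4 * aqFour) - 3 * X * tq ^ 2 * ef 12 ^ 3)) ?_).2.2
  rw [e1, phi_factor, psi_factor, ef_four_cube_dissection]
  simp only [map_mul, map_add, map_sub, map_neg, map_pow, map_ofNat, expand_X]
  ring

lemma sect_two_main : sect 2 (ef 1 * ef 2 * ef 4 ^ 3 * (ef 6 ^ 3 * eg 3 * eg 12 ^ 2)) =
    (ef 2 ^ 3 * eg 1 * eg 4 ^ 2) *
      ((ef 1 * ef 6 ^ 4 * eg 2 * eg 3 ^ 2) *
        (-2 * (ef 4 * aqFour) + 3 * X * tq * ef 12 ^ 3)) := by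
  have h : ef 6 ^ 3 * eg 3 * eg 12 ^ 2 = expand 3 three_ne_zero (ef 2 ^ 3 * eg 1 * eg 4 ^ 2) := by
    simp only [map_mul, map_pow, expand_ef 3 2 6 _ rfl, expand_eg 3 1 3 _ rfl,
      expand_eg 3 4 12 _ rfl]
  rw [mul_comm _ (ef 6 ^ 3 * eg 3 * eg 12 ^ 2), h, sect_expand_mul (by norm_num), sect_two_product]

lemma sect_two_error : sect 2 (X * ef 1 * eg 4 * (ef 6 ^ 2 * ef 12 ^ 2 * eg 3)) =
    (ef 2 ^ 2 * ef 4 ^ 2 * eg 1) * sect 1 (ef 1 * eg 4) := by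
  have h : ef 6 ^ 2 * ef 12 ^ 2 * eg 3 =
      expand 3 three_ne_zero (ef 2 ^ 2 * ef 4 ^ 2 * eg 1) := by
    simp only [map_mul, map_pow, expand_ef 3 2 6 _ rfl, expand_eg 3 1 3 _ rfl,
      expand_ef 3 4 12 _ rfl]
  rw [show X * ef 1 * eg 4 * (ef 6 ^ 2 * ef 12 ^ 2 * eg 3) =
    (ef 6 ^ 2 * ef 12 ^ 2 * eg 3) * (X * (ef 1 * eg 4)) by ring, h,
    sect_expand_mul (by norm_num), sect_succ_X_mul]

lemma red3_sect (i : ℕ) (g : ℤ⟦X⟧) : red3 (sect i g) = sect i (red3 g) := map_sect _ i g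

/-- The iterated section `2, 1` of `f₁² / (f₂² f₄)` modulo 9. -/
lemma sect_two_generating : 9 ∣ sect 2 (sect 1 (ef 1 ^ 2 * eg 2 ^ 2 * eg 4)) -
    (4 * ((ef 2 ^ 2 * eg 4 * aqFour) * (ef 6 ^ 4 * eg 3 ^ 2)) -
      6 * (X * (ef 4 * eg 1) * (ef 3 * ef 6 ^ 2 * ef 12 ^ 2)) +
      6 * (ef 2 ^ 2 * eg 4 * (ef 6 ^ 4 * eg 3 ^ 2))) := by
  have hL := nine_dvd_sect (i := 2) sect_one_generating
  have h1 := ef_mul_eg 1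
  have h2 := ef_mul_eg 2
  have h4 := ef_mul_eg 4
  have h6 := ef_mul_eg 6
  set M := ef 1 * ef 2 * ef 4 ^ 3 * (ef 6 ^ 3 * eg 3 * eg 12 ^ 2) with hM
  set N := X * ef 1 * eg 4 * (ef 6 ^ 2 * ef 12 ^ 2 * eg 3) with hN
  have hlin : sect 2 (sect 1 (ef 1 ^ 2 * eg 2 ^ 2 * eg 4) - (-2 * M + 3 * N)) =
      sect 2 (sect 1 (ef 1 ^ 2 * eg 2 ^ 2 * eg 4)) - (-2 * sect 2 M + 3 * sect 2 N) := by
    have a2 := sect_ofNat_mul 2 2 M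
    have a3 := sect_ofNat_mul 2 3 N
    push_cast at a2 a3
    rw [map_sub, map_add, neg_mul, map_neg, a2, a3, neg_mul]
  rw [hlin, hM, hN, sect_two_main, sect_two_error] at hL
  obtain ⟨z0, d0⟩ := hL
  obtain ⟨z1, d1⟩ := nine_dvd_three_mul (a := X * (ef 2 ^ 3 * ef 3 * ef 6 * ef 12 ^ 3 *
    eg 1 * eg 4 ^ 2)) (b := X * (ef 4 * eg 1) * (ef 3 * ef 6 ^ 2 * ef 12 ^ 2)) (by
      have v4 := uf_mul_ug 4
      simp only [map_mul, map_pow, red3_X, red3_ef, red3_eg, uf_three_mul 2 6 rfl,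
        uf_three_mul 4 12 rfl]
      linear_combination (X * uf 2 ^ 6 * uf 3 * uf 4 ^ 7 * ug 1) * (uf 4 * ug 4 + 1) * v4)
  obtain ⟨z2, d2⟩ := nine_dvd_three_mul (a := (ef 2 ^ 2 * ef 4 ^ 2 * eg 1) * sect 1 (ef 1 * eg 4))
    (b := -(ef 2 ^ 2 * eg 4 * (ef 6 ^ 4 * eg 3 ^ 2))) (by
      have v4 := uf_mul_ug 4
      simp only [map_mul, map_neg, map_pow, red3_sect, red3_ef, red3_eg,
        uf_three_mul 2 6 rfl, ug_three_mul 1 3 rfl, sect_uf_one_div_uf_four.1]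
      linear_combination (-uf 2 ^ 14 * ug 1 ^ 6 * ug 4) * (uf 4 * ug 4 + 1) * v4)
  have e1 : (ef 2 ^ 3 * eg 1 * eg 4 ^ 2) * ((ef 1 * ef 6 ^ 4 * eg 2 * eg 3 ^ 2) *
      (ef 4 * aqFour)) = (ef 2 ^ 2 * eg 4 * aqFour) * (ef 6 ^ 4 * eg 3 ^ 2) := by
    rw [show (ef 2 ^ 3 * eg 1 * eg 4 ^ 2) * ((ef 1 * ef 6 ^ 4 * eg 2 * eg 3 ^ 2) *
      (ef 4 * aqFour)) = (ef 1 * eg 1) * (ef 2 * eg 2) * (ef 4 * eg 4) *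
      ((ef 2 ^ 2 * eg 4 * aqFour) * (ef 6 ^ 4 * eg 3 ^ 2)) by ring, h1, h2, h4]
    simp
  have e2 : (ef 2 ^ 3 * eg 1 * eg 4 ^ 2) * ((ef 1 * ef 6 ^ 4 * eg 2 * eg 3 ^ 2) *
      (X * tq * ef 12 ^ 3)) = X * (ef 2 ^ 3 * ef 3 * ef 6 * ef 12 ^ 3 * eg 1 * eg 4 ^ 2) := by
    have h3 := ef_mul_eg 3
    rw [tq, show (ef 2 ^ 3 * eg 1 * eg 4 ^ 2) * ((ef 1 * ef 6 ^ 4 * eg 2 * eg 3 ^ 2) *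
      (X * (ef 2 * ef 3 ^ 3 * eg 1 * eg 6 ^ 3) * ef 12 ^ 3)) = (ef 1 * eg 1) * (ef 2 * eg 2) *
      (ef 3 * eg 3) ^ 2 * (ef 6 * eg 6) ^ 3 *
      (X * (ef 2 ^ 3 * ef 3 * ef 6 * ef 12 ^ 3 * eg 1 * eg 4 ^ 2)) by ring, h1, h2, h3, h6]
    simp
  -- The last summand of the witness replaces the coefficient -3 by 6.
  refine ⟨z0 - 2 * z1 + z2 - ef 2 ^ 2 * eg 4 * (ef 6 ^ 4 * eg 3 ^ 2), ?_⟩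
  linear_combination d0 + 4 * e1 - 6 * e2 - 2 * d1 + d2

end SecondSection

/-! ### The third section modulo 9 -/

section ThirdSection

lemma sect_one_square_div : sect 1 (ef 2 ^ 2 * eg 4) = 0 := by
  refine (sect_of_eq (a := (ef 2 * ef 12 ^ 2 * eg 4 * eg 6) * sq)
    (c := (ef 2 * ef 12 ^ 2 * eg 4 * eg 6) * (-2)) ?_).2.1
  rw [phi_factor_two]
  simp only [map_mul, map_neg, map_ofNat, map_zero]
  ring

/-- φ(-q²) has exponents 0, 2 and a(q⁴) exponents 0, 1 modulo 3, so class 1 arises in one way only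
and carries the 6 of `aq_dissection`. -/
lemma sect_one_square_div_mul : sect 1 (ef 2 ^ 2 * eg 4 * aqFour) =
    6 * X * (ef 6 ^ 2 * eg 12 * ef 12 ^ 3 * eg 4) := by
  have h2 := ef_mul_eg 2
  have h4 := ef_mul_eg 4
  have h6 := ef_mul_eg 6
  have h12 := ef_mul_eg 12
  have key := (sect_of_eq (g := ef 2 ^ 2 * eg 4 * aqFour)
    (a := (ef 2 * ef 12 ^ 2 * eg 4 * eg 6) * (sq * aqFour - 12 * X ^ 2 * (ef 12 ^ 3 * eg 4)))
    (b := (ef 2 * ef 12 ^ 2 * eg 4 * eg 6) * sq * (6 * X * (ef 12 ^ 3 * eg 4)))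
    (c := (ef 2 * ef 12 ^ 2 * eg 4 * eg 6) * (-2 * aqFour)) (by
      rw [phi_factor_two]
      have h := aqFour_dissection
      set A := expand 3 three_ne_zero aqFour with hA
      simp only [map_mul, map_sub, map_neg, map_pow, map_ofNat, expand_X, ← hA] at h ⊢
      linear_combination ((expand 3 three_ne_zero (ef 2) * expand 3 three_ne_zero (ef 12) ^ 2 *
        expand 3 three_ne_zero (eg 4) * expand 3 three_ne_zero (eg 6)) *
        (expand 3 three_ne_zero sq - 2 * X ^ 2)) * h)).2.1
  rw [key, sq, show (ef 2 * ef 12 ^ 2 * eg 4 * eg 6) * (ef 4 * ef 6 ^ 3 * eg 2 * eg 12 ^ 3) *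
    (6 * X * (ef 12 ^ 3 * eg 4)) = (ef 2 * eg 2) * (ef 4 * eg 4) * (ef 6 * eg 6) *
    (ef 12 * eg 12) ^ 2 * (6 * X * (ef 6 ^ 2 * eg 12 * ef 12 ^ 3 * eg 4)) by ring, h2, h4, h6, h12]
  simp

/-- The remaining factor of the iterated section `1, 2, 1` of `f₁² / (f₂² f₄)`. -/
noncomputable def rest : ℤ⟦X⟧ :=
  ef 1 * ef 2 * ef 6 ^ 3 * eg 3 * (X * (ef 12 ^ 2 * eg 4) - ef 2 * ef 6 * eg 12)

/-- The iterated section `1, 2, 1` of `f₁² / (f₂² f₄)` modulo 9. -/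
lemma sect_three_generating :
    9 ∣ sect 1 (sect 2 (sect 1 (ef 1 ^ 2 * eg 2 ^ 2 * eg 4))) - 6 * rest := by
  have hL := nine_dvd_sect (i := 1) sect_two_generating
  have hpre : ef 6 ^ 4 * eg 3 ^ 2 = expand 3 three_ne_zero (ef 2 ^ 4 * eg 1 ^ 2) := by
    simp only [map_mul, map_pow, expand_ef 3 2 6 _ rfl, expand_eg 3 1 3 _ rfl]
  have hpre' : ef 3 * ef 6 ^ 2 * ef 12 ^ 2 =
      expand 3 three_ne_zero (ef 1 * ef 2 ^ 2 * ef 4 ^ 2) := by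
    simp only [map_mul, map_pow, expand_ef 3 2 6 _ rfl, expand_ef 3 1 3 _ rfl,
      expand_ef 3 4 12 _ rfl]
  have s1 : sect 1 ((ef 2 ^ 2 * eg 4 * aqFour) * (ef 6 ^ 4 * eg 3 ^ 2)) =
      ef 2 ^ 4 * eg 1 ^ 2 * (6 * X * (ef 6 ^ 2 * eg 12 * ef 12 ^ 3 * eg 4)) := by
    rw [mul_comm, hpre, sect_expand_mul (by norm_num), sect_one_square_div_mul]
  have s2 : sect 1 (X * (ef 4 * eg 1) * (ef 3 * ef 6 ^ 2 * ef 12 ^ 2)) =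
      (ef 1 * ef 2 ^ 2 * ef 4 ^ 2) * sect 0 (ef 4 * eg 1) := by
    rw [mul_comm, hpre', sect_expand_mul (by norm_num), sect_succ_X_mul]
  have s3 : sect 1 (ef 2 ^ 2 * eg 4 * (ef 6 ^ 4 * eg 3 ^ 2)) = 0 := by
    rw [mul_comm, hpre, sect_expand_mul (by norm_num), sect_one_square_div, mul_zero]
  set M := (ef 2 ^ 2 * eg 4 * aqFour) * (ef 6 ^ 4 * eg 3 ^ 2)
  set N := X * (ef 4 * eg 1) * (ef 3 * ef 6 ^ 2 * ef 12 ^ 2)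
  set K := ef 2 ^ 2 * eg 4 * (ef 6 ^ 4 * eg 3 ^ 2)
  have hlin : sect 1 (sect 2 (sect 1 (ef 1 ^ 2 * eg 2 ^ 2 * eg 4)) - (4 * M - 6 * N + 6 * K)) =
      sect 1 (sect 2 (sect 1 (ef 1 ^ 2 * eg 2 ^ 2 * eg 4))) -
        (4 * sect 1 M - 6 * sect 1 N + 6 * sect 1 K) := by
    have a2 := sect_ofNat_mul 1 4 M
    have a3 := sect_ofNat_mul 1 6 N
    have a4 := sect_ofNat_mul 1 6 K
    push_cast at a2 a3 a4
    rw [map_sub, map_add, map_sub, a2, a3, a4]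
  rw [hlin, s1, s2, s3] at hL
  obtain ⟨z0, d0⟩ := hL
  obtain ⟨z1, d1⟩ := nine_dvd_three_mul (a := ef 2 ^ 4 * eg 1 ^ 2 *
    (X * (ef 6 ^ 2 * eg 12 * ef 12 ^ 3 * eg 4)) - (ef 1 * ef 2 ^ 2 * ef 4 ^ 2) *
    sect 0 (ef 4 * eg 1)) (b := rest) (by
      have v1 := uf_mul_ug 1
      have v4 := uf_mul_ug 4
      simp only [rest, map_mul, map_sub, map_pow, red3_sect, red3_X, red3_ef, red3_eg,
        uf_three_mul 2 6 rfl, uf_three_mul 4 12 rfl, ug_three_mul 1 3 rfl, ug_three_mul 4 12 rfl,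
        sect_zero_uf_four_div_uf_one]
      linear_combination (-X * uf 2 ^ 10 * ug 1 ^ 2 * uf 4 ^ 6 * ug 4) * v1 +
        (X * uf 2 ^ 10 * ug 1 ^ 2 * uf 4 ^ 6 * ug 4) *
          ((uf 4 * ug 4) ^ 2 + uf 4 * ug 4 + 1) * v4 +
        (-uf 1 * ug 1 ^ 3 * uf 2 ^ 14 * ug 4 ^ 3) * (uf 4 * ug 4 + 1) * v4)
  -- The last summand reduces the coefficient 4 · 6 = 24 to 6.
  refine ⟨z0 + 2 * z1 + 2 * (ef 2 ^ 4 * eg 1 ^ 2 * (X * (ef 6 ^ 2 * eg 12 * ef 12 ^ 3 * eg 4))), ?_⟩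
  linear_combination d0 + 2 * d1

end ThirdSection

/-! ### The last section vanishes modulo 3 -/

section FourthSection

/-- Modulo 3 the product is a cube times q f₁f₂²f₄ minus a cube times f₁/f₄. Both sections are
known, and they cancel by the quadratic and fourth power relations. -/
lemma three_dvd_sect_two_mul_rest :
    3 ∣ sect 2 (ef 2 * ef 12 ^ 2 * eg 4 * eg 6 * rest) := by
  rw [three_dvd_iff_red3, red3_sect]
  have v1 := uf_mul_ug 1
  have v2 := uf_mul_ug 2
  have v4 := uf_mul_ug 4
  have e : red3 (ef 2 * ef 12 ^ 2 * eg 4 * eg 6 * rest) =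
      (uf 4 ^ 3 * uf 2 ^ 2 * ug 1) ^ 3 * (X * (uf 1 * uf 2 ^ 2 * uf 4)) -
        (uf 2 ^ 4 * uf 4 * ug 1) ^ 3 * (uf 1 * ug 4) := by
    simp only [rest, map_mul, map_sub, map_pow, red3_X, red3_ef, red3_eg,
      uf_three_mul 2 6 rfl, uf_three_mul 4 12 rfl, ug_three_mul 1 3 rfl, ug_three_mul 4 12 rfl,
      ug_three_mul 2 6 rfl]
    have w2 : uf 2 ^ 3 * ug 2 ^ 3 = 1 := by rw [← mul_pow, v2, one_pow]
    have w4 : uf 4 ^ 3 * ug 4 ^ 3 = 1 := by rw [← mul_pow, v4, one_pow]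
    linear_combination (uf 2 ^ 2 * uf 4 ^ 6 * ug 4 * uf 1 * uf 2 ^ 6 * ug 1 ^ 3 *
      (X * uf 4 ^ 6 * ug 4 - uf 2 ^ 4 * ug 4 ^ 3)) * w2 +
      (X * uf 2 ^ 8 * uf 4 ^ 10 * uf 1 * ug 1 ^ 3) * (uf 4 * ug 4 + 1) * v4
      - (uf 2 ^ 12 * ug 4 * uf 4 ^ 3 * uf 1 * ug 1 ^ 3) * w4
  have a : uf 2 ^ 2 * ug 2 ^ 2 = 1 := by rw [← mul_pow, v2, one_pow]
  rw [e, map_sub, sect_pow_three_mul (by norm_num), sect_pow_three_mul (by norm_num),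
    sect_succ_X_mul, sect_one_uf_product, sect_uf_one_div_uf_four.2]
  have hq := uf_quadratic_relation
  have hf := uf_fourth_power_relation
  have hb : (2 * uf 1 ^ 8 * uf 2 ^ 24 + 2 * X * uf 2 ^ 24 * uf 4 ^ 8 +
      X * uf 1 ^ 16 * uf 4 ^ 16) - uf 2 ^ 4 * (uf 1 ^ 16 * uf 4 ^ 8 + uf 2 ^ 24) = 0 := by
    linear_combination (-uf 1 ^ 8) * hq + (uf 1 ^ 16 * uf 4 ^ 8 + uf 2 ^ 24) * hf +
      (X * uf 2 ^ 24 * uf 4 ^ 8 + X * uf 1 ^ 16 * uf 4 ^ 16) * three_eq_zero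
  have w4 : uf 4 ^ 3 * ug 4 ^ 3 = 1 := by rw [← mul_pow, v4, one_pow]
  linear_combination (ug 1 ^ 6 * ug 2 ^ 8 * ug 4 ^ 2) * hb +
    (ug 1 ^ 6 * ug 2 ^ 8 * ug 4 ^ 2) * (2 * uf 1 ^ 8 * uf 2 ^ 24 + 2 * X * uf 2 ^ 24 * uf 4 ^ 8 +
      X * uf 1 ^ 16 * uf 4 ^ 16) * (w4 + (uf 4 ^ 3 * ug 4 ^ 3) * a) -
    (ug 1 ^ 6 * ug 2 ^ 8 * ug 4 ^ 2) * uf 2 ^ 4 * (uf 1 ^ 16 * uf 4 ^ 8 + uf 2 ^ 24) * v4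

end FourthSection

/-! ### The theta series without the weight 3k+1 -/

section Theta

/-- The `k`-th term of the theta series `∑ (-1)ᵏ q^{2k(3k+2)}`. -/
noncomputable def omegaTerm (k : ℤ) : ℤ⟦X⟧ :=
  C ((k.negOnePow : ℤˣ) : ℤ) * X ^ (2 * k * (3 * k + 2)).toNat

lemma expand_two_thetaTerm (k : ℤ) :
    expand 2 two_ne_zero (thetaTerm (-X ^ 5) (-X : ℤ⟦X⟧) k) = omegaTerm k := by
  have h1 := two_mul_tri k
  have h2 := two_mul_tri (-k)
  have e : (2 * k * (3 * k + 2)).toNat = 10 * tri k + 2 * tri (-k) := by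
    zify
    rw [Int.toNat_of_nonneg (by nlinarith)]
    linarith
  have hs : ((k.negOnePow : ℤˣ) : ℤ) = (-1) ^ (tri k + tri (-k)) := by
    have hk : Even (tri k + tri (-k)) ↔ Even k := by
      have e2 : ((tri k + tri (-k) : ℕ) : ℤ) = k * k := by push_cast; linarith
      rw [← Int.even_coe_nat, e2, Int.even_mul, or_self]
    rcases Int.even_or_odd k with h | h
    · rw [Int.negOnePow_even k h, Even.neg_one_pow (hk.mpr h), Units.val_one]
    · rw [Int.negOnePow_odd k h, Odd.neg_one_pow]
      · simp
      · rw [← Nat.not_even_iff_odd, hk, Int.not_even_iff_odd]; exact h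
  rw [omegaTerm, e, hs, expand_thetaTerm, thetaTerm]
  simp only [map_neg, map_pow, expand_X, map_one]
  rw [neg_pow, neg_pow (X ^ 2)]
  ring

lemma hasSum_omegaTerm : HasSum omegaTerm (ef 2 * ef 12 ^ 2 * eg 4 * eg 6) := by
  have h := hasSum_expand 2 two_ne_zero hasSum_omega
  simp only [map_mul, map_pow, expand_ef 2 1 2 _ rfl, expand_ef 2 6 12 _ rfl,
    expand_eg 2 2 4 _ rfl, expand_eg 2 3 6 _ rfl] at h
  simpa only [expand_two_thetaTerm] using h

lemma coeff_omegaTerm_mul (c : ℤ) (W : ℤ⟦X⟧) (m : ℕ) (k : ℤ) :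
    coeff m (C c * omegaTerm k * W) = c * ((k.negOnePow : ℤˣ) : ℤ) *
      (if 2 * k * (3 * k + 2) ≤ m then coeff ((m : ℤ) - 2 * k * (3 * k + 2)).toNat W else 0) := by
  have h0 : 0 ≤ 2 * k * (3 * k + 2) := by
    rcases le_or_gt 0 k with h | h <;> nlinarith
  rw [omegaTerm, ← mul_assoc, ← map_mul, mul_assoc, coeff_C_mul, coeff_X_pow_mul']
  obtain ⟨j, hj⟩ := Int.eq_ofNat_of_zero_le h0
  rw [hj]
  congr 1
  rw [show ((m : ℤ) - (j : ℕ)).toNat = m - j by omega]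
  simp only [Int.toNat_natCast, Nat.cast_le]

end Theta

/-! ### The generating function of B at -q -/

section GeneratingFunction

/-- The generating function of partitions into distinct odd parts. -/
noncomputable def oddDistinctSeries : ℤ⟦X⟧ :=
  PowerSeries.mk fun n ↦ (#(Nat.Partition.oddDistincts n) : ℤ)

/-- The generating function of partitions into multiples of 4. -/
noncomputable def multFourSeries : ℤ⟦X⟧ :=
  PowerSeries.mk fun n ↦ (#(Nat.Partition.restricted n (fun i ↦ 4 ∣ i)) : ℤ)

lemma oddDistinctSeries_eq_genFun : oddDistinctSeries =
    Nat.Partition.genFun (fun i c ↦ if ¬ Even i ∧ c < 2 then (1 : ℤ) else 0) := by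
  ext n
  have h : Nat.Partition.oddDistincts n =
      univ.filter fun p : n.Partition ↦ ∀ i ∈ p.parts, ¬ Even i ∧ p.parts.count i < 2 := by
    ext p
    rw [Nat.Partition.oddDistincts, ← Nat.Partition.countRestricted_two]
    simp [Nat.Partition.odds, Nat.Partition.restricted, Nat.Partition.countRestricted, forall_and]
  rw [oddDistinctSeries, coeff_mk, Nat.Partition.coeff_genFun, h, card_filter]
  simp_rw [Finsupp.prod, prod_boole]
  simp

lemma hasProd_genFun_odd_distinct (R : Type*) [CommSemiring R] [TopologicalSpace R] [T2Space R] :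
    HasProd (fun i : ℕ ↦ if Even (i + 1) then (1 : R⟦X⟧) else 1 + X ^ (i + 1))
      (Nat.Partition.genFun (fun i c ↦ if ¬ Even i ∧ c < 2 then (1 : R) else 0)) := by
  convert! Nat.Partition.hasProd_genFun (fun i c ↦ if ¬ Even i ∧ c < 2 then (1 : R) else 0) using 1
  ext1 i
  rw [tsum_eq_single 0 (fun j hj ↦ by rw [if_neg (by omega), zero_smul])]
  split_ifs <;> simp_all

lemma hasProd_oddDistinctSeries : HasProd (fun i : ℕ ↦ 1 + (X : ℤ⟦X⟧) ^ (2 * i + 1))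
    oddDistinctSeries := by
  have h := hasProd_genFun_odd_distinct ℤ
  rw [← oddDistinctSeries_eq_genFun] at h
  have hinj : Function.Injective (fun m : ℕ ↦ 2 * m) := fun a b hab ↦ by
    have : 2 * a = 2 * b := hab
    omega
  have h' := (hinj.hasProd_iff ?_).mpr h
  · simpa [Function.comp_def] using h'
  · intro i hi
    rw [if_pos]
    rw [Nat.even_add_one, Nat.not_even_iff_odd, ← Nat.not_even_iff_odd, even_iff_exists_two_mul]
    rintro ⟨m, rfl⟩
    exact hi ⟨m, rfl⟩

lemma rescale_oddDistinctSeries : rescale (-1) oddDistinctSeries = ef 1 * eg 2 := by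
  have h := hasProd_oddDistinctSeries.map (rescale (-1 : ℤ)) (continuous_rescale _)
  have e : rescale (-1) oddDistinctSeries = prog (-1) 2 1 := by
    refine h.unique ?_
    convert hasProd_prog (-1) 2 1 using 2 with i
    simp only [Function.comp_apply, map_add, map_one, map_pow, rescale_X, mul_pow, map_neg]
    rw [Odd.neg_one_pow ⟨i, rfl⟩]
  rw [e, ef_split_two, mul_assoc, ef_mul_eg, mul_one]

lemma multFourSeries_mul_ef : multFourSeries * ef 4 = 1 := by
  have h1 := Nat.Partition.hasProd_powerSeriesMk_card_restricted ℤ (fun i ↦ 4 ∣ i)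
  have h2 : HasProd (fun n ↦ if 4 ∣ n + 1 then 1 - (X : ℤ⟦X⟧) ^ (n + 1) else 1) (ef 4) := by
    have hinj : Function.Injective (fun m : ℕ ↦ 4 * m + 3) := fun a b hab ↦ by
      have : 4 * a + 3 = 4 * b + 3 := hab
      omega
    refine (hinj.hasProd_iff ?_).mp ?_
    · intro n hn
      rw [if_neg]
      rintro ⟨m, hm⟩
      exact hn ⟨m - 1, show 4 * (m - 1) + 3 = n by omega⟩
    · convert hasProd_ef 4 using 2 with n
      rw [Function.comp_apply, if_pos ⟨n + 1, by ring⟩]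
      rfl
  refine (h1.mul h2).unique ?_
  convert hasProd_one with n
  split_ifs with h
  · simp_rw [pow_mul]
    exact WithPiTopology.tsum_pow_mul_one_sub_of_constantCoeff_eq_zero (by simp)
  · exact one_mul 1

lemma rescale_ef_four : rescale (-1) (ef 4) = ef 4 := by
  refine ((hasProd_ef 4).map (rescale (-1 : ℤ)) (continuous_rescale _)).unique ?_
  convert hasProd_ef 4 using 2 with n
  simp only [Function.comp_apply, map_sub, map_one, map_pow, rescale_X, mul_pow, map_neg]
  rw [Even.neg_one_pow ⟨2 * (n + 1), by ring⟩, one_mul]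

lemma rescale_multFourSeries : rescale (-1) multFourSeries = eg 4 := by
  have h := congrArg (rescale (-1 : ℤ)) multFourSeries_mul_ef
  rw [map_mul, rescale_ef_four, map_one] at h
  have h4 := ef_mul_eg 4
  linear_combination eg 4 * h - (rescale (-1) multFourSeries) * h4

lemma mk_linB : PowerSeries.mk (fun n ↦ (linB n : ℤ)) =
    oddDistinctSeries * (oddDistinctSeries * multFourSeries) := by
  ext n
  rw [coeff_mk, linB, linTriples, card_sigma, coeff_mul]
  simp_rw [coeff_mul, mul_sum, card_product]
  rw [sum_sigma', Nat.cast_sum]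
  refine sum_nbij' (fun m ↦ ⟨(m 0, m 1 + m 2), (m 1, m 2)⟩) (fun s ↦ ![s.1.1, s.2.1, s.2.2])
    ?_ ?_ ?_ ?_ ?_
  · intro m hm
    have := Finset.Nat.mem_antidiagonalTuple.mp hm
    simp only [Fin.sum_univ_three] at this
    simp only [mem_sigma, HasAntidiagonal.mem_antidiagonal, and_true]
    omega
  · rintro ⟨⟨a, b⟩, ⟨c, d⟩⟩ h
    simp only [mem_sigma, HasAntidiagonal.mem_antidiagonal] at h
    rw [Finset.Nat.mem_antidiagonalTuple]
    simp [Fin.sum_univ_three]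
    omega
  · intro m _
    ext i
    fin_cases i <;> rfl
  · rintro ⟨⟨a, b⟩, ⟨c, d⟩⟩ h
    simp only [mem_sigma, HasAntidiagonal.mem_antidiagonal] at h
    obtain ⟨-, rfl⟩ := h
    rfl
  · intro m _
    simp [oddDistinctSeries, multFourSeries]

lemma coeff_generating (m : ℕ) :
    coeff m (ef 1 ^ 2 * eg 2 ^ 2 * eg 4) = (-1) ^ m * (linB m : ℤ) := by
  have h := congrArg (fun g ↦ coeff m (rescale (-1 : ℤ) g)) mk_linB
  simp only [map_mul, rescale_oddDistinctSeries, rescale_multFourSeries] at h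
  rw [coeff_rescale, coeff_mk] at h
  rw [h]
  congr 1
  ring

end GeneratingFunction

/-! ### Assembling the congruence -/

section Conclusion

lemma exists_hasSum_int_mul_omegaTerm :
    ∃ S : ℤ⟦X⟧, HasSum (fun k : ℤ ↦ C k * omegaTerm k) S := by
  refine ⟨PowerSeries.mk fun d ↦ ∑ k ∈ Icc (-(d : ℤ)) d, coeff d (C k * omegaTerm k), ?_⟩
  rw [WithPiTopology.hasSum_iff_hasSum_coeff]
  intro d
  rw [coeff_mk]
  refine hasSum_sum_of_ne_finset_zero fun k hk ↦ ?_
  rw [omegaTerm, coeff_C_mul, coeff_C_mul, coeff_X_pow, if_neg, mul_zero, mul_zero]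
  rw [mem_Icc, not_and_or, not_le, not_le] at hk
  intro h
  have h2 : (d : ℤ) = 2 * k * (3 * k + 2) := by
    rw [h, Int.toNat_of_nonneg]
    rcases le_or_gt 0 k with h | h <;> nlinarith
  rcases hk with hk | hk <;> nlinarith

lemma exists_hasSum_theta : ∃ S T : ℤ⟦X⟧, HasSum (fun k : ℤ ↦ C (3 * k + 1) * omegaTerm k) S ∧
    S = ef 2 * ef 12 ^ 2 * eg 4 * eg 6 + 3 * T := by
  obtain ⟨T, hT⟩ := exists_hasSum_int_mul_omegaTerm
  refine ⟨_, T, ?_, rfl⟩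
  convert hasSum_omegaTerm.add (hT.mul_left 3) using 2 with k
  rw [map_add, map_mul, map_one, map_ofNat]
  ring

lemma nine_dvd_sect_two_theta {S T : ℤ⟦X⟧} (e : S = ef 2 * ef 12 ^ 2 * eg 4 * eg 6 + 3 * T) :
    9 ∣ sect 2 (S * sect 1 (sect 2 (sect 1 (ef 1 ^ 2 * eg 2 ^ 2 * eg 4)))) := by
  obtain ⟨z, hz⟩ := sect_three_generating
  obtain ⟨w, hw⟩ := three_dvd_sect_two_mul_rest
  set W := sect 1 (sect 2 (sect 1 (ef 1 ^ 2 * eg 2 ^ 2 * eg 4)))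
  have e2 : S * W = (6 : ℕ) * (ef 2 * ef 12 ^ 2 * eg 4 * eg 6 * rest) +
      (9 : ℕ) * (z * S + 2 * T * rest) := by
    push_cast
    linear_combination S * hz + 6 * rest * e
  rw [e2, map_add, sect_ofNat_mul, sect_ofNat_mul, hw]
  refine ⟨2 * w + sect 2 (z * S + 2 * T * rest), ?_⟩
  push_cast
  ring

lemma linB_term_eq_zero {n : ℕ} {k : ℤ} (hk : k ∉ Icc (-(n + 2) : ℤ) (n + 2)) :
    linBInt (81 * (n : ℤ) + 70 - 54 * k * (3 * k + 2)) = 0 := by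
  rw [linBInt, if_neg]
  rw [mem_Icc, not_and_or, not_le, not_le] at hk
  rcases hk with hk | hk <;> nlinarith

lemma coeff_theta_term (n : ℕ) (k : ℤ) :
    coeff (3 * n + 2) (C (3 * k + 1) * omegaTerm k *
      sect 1 (sect 2 (sect 1 (ef 1 ^ 2 * eg 2 ^ 2 * eg 4)))) =
    (-1) ^ n * (((k.negOnePow : ℤˣ) : ℤ) * (3 * k + 1) *
        linBInt (81 * (n : ℤ) + 70 - 54 * k * (3 * k + 2))) := by
  rw [coeff_omegaTerm_mul]
  have e : 81 * (n : ℤ) + 70 - 54 * k * (3 * k + 2) =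
      27 * (((3 * n + 2 : ℕ) : ℤ) - 2 * k * (3 * k + 2)) + 16 := by push_cast; ring
  rw [e]
  split_ifs with h
  · obtain ⟨j, hj⟩ := Int.eq_ofNat_of_zero_le (sub_nonneg.mpr h)
    rw [hj, coeff_sect, coeff_sect, coeff_sect, coeff_generating, linBInt,
      if_pos (by positivity)]
    rw [show (27 * ((j : ℕ) : ℤ) + 16).toNat = 27 * j + 16 by omega,
      show 3 * (3 * (3 * ((j : ℤ)).toNat + 1) + 2) + 1 = 27 * j + 16 by omega]
    -- The sign does not depend on `k`: `j` differs from `3n + 2` by an even number.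
    have hs : (-1 : ℤ) ^ (27 * j + 16) = (-1) ^ n := by
      have hp : Even (27 * j + 16) ↔ Even n := by
        have h1 : (j : ℤ) = 3 * n + 2 - 2 * (k * (3 * k + 2)) := by
          rw [← hj]; push_cast; ring
        generalize k * (3 * k + 2) = u at h1
        rw [Nat.even_iff, Nat.even_iff]
        omega
      rcases Nat.even_or_odd n with h | h
      · rw [h.neg_one_pow, (hp.mpr h).neg_one_pow]
      · rw [h.neg_one_pow, Odd.neg_one_pow]
        rw [← Nat.not_even_iff_odd, hp, Nat.not_even_iff_odd]
        exact h
    rw [hs]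
    ring
  · rw [linBInt, if_neg (by omega)]
    simp

lemma finite_support_theta_linB (n : ℕ) :
    {k : ℤ | ((k.negOnePow : ℤˣ) : ℤ) * (3 * k + 1) *
      linBInt (81 * (n : ℤ) + 70 - 54 * k * (3 * k + 2)) ≠ 0}.Finite := by
  refine (Finset.Icc (-(n + 2) : ℤ) (n + 2)).finite_toSet.subset fun k hk ↦ ?_
  by_contra h
  exact hk (by rw [linB_term_eq_zero (by simpa using h), mul_zero])

lemma finsum_theta_linB_modEq_zero (n : ℕ) :
    (∑ᶠ k : ℤ, ((k.negOnePow : ℤˣ) : ℤ) * (3 * k + 1) *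
      linBInt (81 * (n : ℤ) + 70 - 54 * k * (3 * k + 2))) ≡ 0 [ZMOD 9] := by
  obtain ⟨S, T, hS, e⟩ := exists_hasSum_theta
  have h9 := nine_dvd_sect_two_theta e
  have hc := (hS.mul_right (sect 1 (sect 2 (sect 1 (ef 1 ^ 2 * eg 2 ^ 2 * eg 4))))).map
    (PowerSeries.coeff (3 * n + 2)) (PowerSeries.WithPiTopology.continuous_coeff ℤ _)
  obtain ⟨z, hz⟩ := h9
  have hz' := congrArg (PowerSeries.coeff n) hz
  rw [coeff_sect, ← map_ofNat (PowerSeries.C (R := ℤ)) 9, PowerSeries.coeff_C_mul] at hz'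
  rw [hz'] at hc
  simp only [Function.comp_def, coeff_theta_term] at hc
  have hsum : ∑' k : ℤ, ((k.negOnePow : ℤˣ) : ℤ) * (3 * k + 1) *
      linBInt (81 * (n : ℤ) + 70 - 54 * k * (3 * k + 2)) =
      (-1) ^ n * (9 * PowerSeries.coeff n z) := by
    have hs (x : ℤ) : (-1) ^ n * ((-1) ^ n * x) = x := by
      rw [← mul_assoc, ← mul_pow]
      norm_num
    have hd := hc.mul_left ((-1) ^ n)
    simp only [hs] at hd
    exact hd.tsum_eq
  -- Finite support lets the coefficientwise infinite sum be read as the finite sum of the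
  -- statement.
  rw [← tsum_eq_finsum (L := SummationFilter.unconditional ℤ) (finite_support_theta_linB n), hsum,
    Int.modEq_zero_iff_dvd]
  exact ⟨(-1) ^ n * PowerSeries.coeff n z, by ring⟩

end Conclusion

end ThetaDissection

theorem theorem1p6 (n : ℕ) :
    {k : ℤ | ((k.negOnePow : ℤˣ) : ℤ) * (3 * k + 1) *
        linBInt (81 * (n : ℤ) + 70 - 54 * k * (3 * k + 2)) ≠ 0}.Finite ∧
    (∑ᶠ k : ℤ, ((k.negOnePow : ℤˣ) : ℤ) * (3 * k + 1) *
        linBInt (81 * (n : ℤ) + 70 - 54 * k * (3 * k + 2))) ≡ 0 [ZMOD 9] :=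
  ⟨ThetaDissection.finite_support_theta_linB n, ThetaDissection.finsum_theta_linB_modEq_zero n⟩
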